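/- Let $G=(V,E)$ be a finite connected digraph without loops or multiple arcs (opposite arcs are allowed), with arc lengths $\ell_{ij}>0$ and a source vector $b\in\mathbb R^V$, $\sum_i b_i=0$. A positive flow is a $\phi\in\mathbb R^E$ with $\phi\ge 0$ and $\sum_{ij\in E}\phi_{ij}-\sum_{ki\in E}\phi_{ki}=b_i$ for all $i\in V$; the problem of minimising $\sum_{ij}\ell_{ij}\phi_{ij}$ over positive flows is feasible if a positive flow exists. Its dual is to maximise $\sum_i p_ib_i$ over $p\in\mathbb R^V$ with $p_i-p_j\le\ell_{ij}$ for all $ij\in E$. Write $\Psi(p)_{ij}=(p_i-p_j)/\ell_{ij}$. Let $\hat H$ be the subgraph formed by the arcs that carry a nonzero amount in some minimum cost positive flow, together with their endpoints. A run of the Physarum solver consists of conductivities $\sigma_{ij}(t)>0$ ($ij\in E$) and potentials $p(t)\in\mathbb R^V$, $t\in[0,\infty)$, such that the currents $\phi_{ij}(t)=\sigma_{ij}(t)\Psi(p(t))_{ij}$ satisfy $\sum_{ij\in E}\phi_{ij}(t)-\sum_{ki\in E}\phi_{ki}(t)=b_i$ for all $i$, $\min_i p_i(t)=0$, and $\frac{d}{dt}\sigma_{ij}(t)+\sigma_{ij}(t)=\phi_{ij}(t)$.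 Let $\hat p$ be the potential on $V(\hat H)$ with $\Psi(\hat p)=1$ on every arc of $\hat H$ and $\min\hat p=0$. For a subgraph $H$ of $G$ with a potential $p$ on $V(H)$, a trajectory to $H$ is a directed path $\pi$ of $G$, not contained in $H$, with both endpoints in $V(H)$ and all internal vertices outside $V(H)$; its slope is $(p_a-p_c)/\ell(\pi)$, where $a$ is its first vertex, $c$ its last vertex and $\ell(\pi)$ its length. Start with $(\hat H,\hat p)$; as long as there is a trajectory of positive slope, add one of maximum slope to $H$ and extend $p$ along it so that $\Psi(p)$ is constant on it. Let $(H^*,p^*)$ be the pair at which this stops. **Theorem.** Assume that $\hat H$ is connected (in particular non-empty) and that the problem is feasible. Then $\hat p$ exists and is unique, and $(H^*,p^*)$ is well defined and does not depend on how ties are broken. The potential $p^*$ on $V(H^*)$ is the unique extension of $\hat p$ that is discrete $\infty$-harmonic on $H^*\setminus\operatorname{supp}b$, i.e. such that for every $i\in V(H^*)\setminus\operatorname{supp}b$ $$\max_{k:\,ki\in E(H^*)}\Psi(p^*)_{ki}=\max_{j:\,ij\in E(H^*)}\Psi(p^*)_{ij}\ge 0$$ (both maxima being over non-empty sets). It satisfies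 $\Psi(p^*)_{ij}\le 1$ for every arc $ij\in E$ with $i,j\in V(H^*)$, and it is the restriction to $V(H^*)$ of an optimal solution of the dual problem. For every run of the Physarum solver, $$\bigl\|p(t)|_{V(H^*)}-p^*|_{V(H^*)}\bigr\|_\infty=e^{-\Omega(t)}\qquad(t\to\infty),$$ i.e. there is $c>0$ such that the left-hand side is at most $e^{-ct}$ for all sufficiently large $t$. -/

import Mathlib

open Filter

/-- A transshipment problem `(G, b, ℓ)`: a finite connected digraph `G` with vertex set `V` and
arcs indexed by `E` (no loops, no multiple arcs; opposite arcs `ij`, `ji` are allowed), positive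
arc lengths `ℓ`, and a source vector `b` with total sum zero. -/
structure TransshipmentProblem (V E : Type*) [Fintype V] where
  tail : E → V
  head : E → V
  loopless : ∀ e, tail e ≠ head e
  simple : ∀ e f, tail e = tail f → head e = head f → e = f
  connected : (SimpleGraph.fromRel fun i j => ∃ e, tail e = i ∧ head e = j).Connected
  len : E → ℝ
  len_pos : ∀ e, 0 < len e
  b : V → ℝ
  sum_b : ∑ i, b i = 0

namespace TransshipmentProblem

variable {V E : Type*} [Fintype V] [Fintype E] [DecidableEq V] [DecidableEq E]
  (N : TransshipmentProblem V E)

/-! ### Flows, the primal and the dual problem -/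

/-- The boundary operator `B`: `+1` at the tail of an arc, `-1` at its head. -/
def boundary : Matrix V E ℝ := fun i e =>
  if i = N.tail e then 1 else if i = N.head e then -1 else 0

/-- `φ` is a positive `b`-flow: `B φ = b` and `φ ≥ 0`. -/
def IsPosFlow (φ : E → ℝ) : Prop :=
  N.boundary.mulVec φ = N.b ∧ ∀ e, 0 ≤ φ e

/-- The problem is feasible: a positive `b`-flow exists. -/
def Feasible : Prop := ∃ φ, N.IsPosFlow φ

/-- The cost `ℓ(φ)`. -/
def cost (φ : E → ℝ) : ℝ := ∑ e, N.len e * φ e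

/-- `φ` is a positive flow of minimum cost. -/
def IsOptFlow (φ : E → ℝ) : Prop :=
  N.IsPosFlow φ ∧ ∀ φ', N.IsPosFlow φ' → N.cost φ ≤ N.cost φ'

/-- The field `Ψ(p) = Bᵀ p / ℓ`, i.e. `(p_i - p_j) / ℓ_ij` on the arc `ij`. -/
noncomputable def field (p : V → ℝ) (e : E) : ℝ :=
  (p (N.tail e) - p (N.head e)) / N.len e

/-- `p` is feasible for the dual problem: `Bᵀ p ≤ ℓ`. -/
def IsDualFeasible (p : V → ℝ) : Prop :=
  ∀ e, p (N.tail e) - p (N.head e) ≤ N.len e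

/-- `p` solves the dual problem: maximise `pᵀ b` subject to `Bᵀ p ≤ ℓ`. -/
def IsDualOptimal (p : V → ℝ) : Prop :=
  N.IsDualFeasible p ∧ ∀ q, N.IsDualFeasible q → ∑ i, q i * N.b i ≤ ∑ i, p i * N.b i

/-! ### Subgraphs, given by their arc sets -/

/-- The vertex set `V(H)` of the subgraph with arc set `H`. -/
def verts (H : Set E) : Set V := {i | ∃ e ∈ H, N.tail e = i ∨ N.head e = i}

/-- The subgraph with arc set `H` is connected (its underlying undirected graph, on `V(H)`). -/
def ConnectedSub (H : Set E) : Prop :=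
  ((SimpleGraph.fromRel fun i j => ∃ e ∈ H, N.tail e = i ∧ N.head e = j).induce
    (N.verts H)).Connected

/-- The optimal set `Ĥ`: the arcs that support some minimum cost flow. -/
def optSet : Set E := {e | ∃ φ, N.IsOptFlow φ ∧ φ e ≠ 0}

/-- `p` restricts on `V(Ĥ)` to the potential `p̂` of the optimal set: its field is `1` on every
arc of `Ĥ`, and its minimum over `V(Ĥ)` is `0`. -/
def IsOptPotential (p : V → ℝ) : Prop :=
  (∀ e ∈ N.optSet, N.field p e = 1) ∧ IsLeast (p '' N.verts N.optSet) 0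

/-- `p` (restricted to `V(H)`) is discrete `∞`-harmonic on `H ∖ S`: at every vertex of `H` outside
`S`, the maximum of the field over the in-going arcs of `H` and the maximum over the out-going arcs
of `H` exist, are equal, and are nonnegative. -/
def IsInfHarmonic (H : Set E) (S : Set V) (p : V → ℝ) : Prop :=
  ∀ i ∈ N.verts H, i ∉ S → ∃ r : ℝ, 0 ≤ r ∧
    IsGreatest (N.field p '' {e | e ∈ H ∧ N.head e = i}) r ∧
    IsGreatest (N.field p '' {e | e ∈ H ∧ N.tail e = i}) r

/-! ### The construction of `(H*, p*)`

A pair `(H, p)` of a subgraph and a potential on `V(H)` is an element of `Set E × (V → ℝ)`; the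
values of `p` outside `V(H)` are never used. -/

/-- The list of arcs `π` is a directed walk from `a` to `c`. -/
def IsDirWalk : List E → V → V → Prop
  | [], a, c => a = c
  | e :: π, a, c => N.tail e = a ∧ IsDirWalk π (N.head e) c

/-- `π` is a directed trajectory to `H` from `a` to `c`: a directed path of `G` (no vertex is
repeated) that is not contained in `H`, with both endpoints in `V(H)` and every internal vertex
outside `V(H)`. -/
structure IsTrajectory (H : Set E) (π : List E) (a c : V) : Prop where
  walk : N.IsDirWalk π a c
  nodup : (a :: π.map N.head).Nodup
  start_mem : a ∈ N.verts H
  end_mem : c ∈ N.verts H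
  internal : ∀ i ∈ (π.map N.head).dropLast, i ∉ N.verts H
  new : ∃ e ∈ π, e ∉ H

/-- The `p`-slope `(p_a - p_c) / ℓ(π)` of a directed path `π` from `a` to `c`. -/
noncomputable def slope (p : V → ℝ) (π : List E) (a c : V) : ℝ :=
  (p a - p c) / (π.map N.len).sum

/-- `(H', p')` is an elementary extension of `(H, p)`: a trajectory `π` to `H` of maximum, and
positive, slope is added to `H`, and `p` is extended with constant slope along `π`. Ties between
trajectories of maximum slope may be broken in any way. -/
def ElemExt (X Y : Set E × (V → ℝ)) : Prop :=
  ∃ π a c, N.IsTrajectory X.1 π a c ∧ 0 < N.slope X.2 π a c ∧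
    (∀ π' a' c', N.IsTrajectory X.1 π' a' c' → N.slope X.2 π' a' c' ≤ N.slope X.2 π a c) ∧
    Y.1 = X.1 ∪ {e | e ∈ π} ∧
    (∀ i ∈ N.verts X.1, Y.2 i = X.2 i) ∧
    (∀ e ∈ π, N.field Y.2 e = N.slope X.2 π a c)

/-- `(H, p)` is a possible outcome `(H*, p*)` of the construction: it is obtained from `(Ĥ, p̂)` by
finitely many elementary extensions, and no trajectory to `H` of positive slope is left. -/
def IsConstructed (H : Set E) (p : V → ℝ) : Prop :=
  (∃ p₀, N.IsOptPotential p₀ ∧ Relation.ReflTransGen N.ElemExt (N.optSet, p₀) (H, p)) ∧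
    ∀ π a c, N.IsTrajectory H π a c → N.slope p π a c ≤ 0

/-! ### The Physarum solver -/

/-- The weighted Laplacian `L(σ) = B diag(σ/ℓ) Bᵀ`. -/
noncomputable def laplacian (σ : E → ℝ) : Matrix V V ℝ :=
  N.boundary * Matrix.diagonal (fun e => σ e / N.len e) * N.boundary.transpose

/-- The current `φ = σ Ψ(p)` given by Ohm's law. -/
noncomputable def current (σ : E → ℝ) (p : V → ℝ) (e : E) : ℝ := σ e * N.field p e

/-- The conductivities `σ(t)` and potentials `p(t)`, `t ≥ 0`, form a run of the Physarum solver: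
the conductivities stay positive, `p(t)` solves Kirchhoff's equations `L(σ(t)) p(t) = b` and has
lowest value zero, and `σ' + σ = φ`, where `φ(t)` is the current. -/
structure IsPhysarumRun (σ : ℝ → E → ℝ) (p : ℝ → V → ℝ) : Prop where
  pos : ∀ t, 0 ≤ t → ∀ e, 0 < σ t e
  kirchhoff : ∀ t, 0 ≤ t → (N.laplacian (σ t)).mulVec (p t) = N.b
  lowest : ∀ t, 0 ≤ t → IsLeast (Set.range (p t)) 0
  ode : ∀ t, 0 ≤ t → ∀ e,
    HasDerivWithinAt (fun s => σ s e) (N.current (σ t) (p t) e - σ t e) (Set.Ici 0) t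

end TransshipmentProblem

/-!
The potentials of the construction are controlled by two facts about walks. If all trajectories to
`H` have slope at most `s ≥ 0`, then `p` extends from `V(H)` to a potential `q` on all of `V` with
field at most `s` outside `H` (`exists_extension_of_slope_le`, a directed McShane extension), and
such a `q` bounds the slopes of trajectories. It has field exactly `s` along any trajectory of
slope `s`, so it is also an extension for the next stage; hence the slopes decrease along the
construction and the limit potential is `∞`-harmonic (`ConstructionInvariant.step`). The first
stage uses linear programming duality for the optimal set
(`exists_isOptPotential_field_le_one`), and the final `q`, with field at most `0` outside `H*`, is
dual optimal. Conversely, in an `∞`-harmonic potential an arc of large field can be followed in both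
directions up to `V(H)` (`exists_mem_le_of_follow`), which forces every `∞`-harmonic extension to
agree with the construction stage by stage (`subset_and_eqOn_of_reflTransGen`). This yields all
uniqueness claims and an induction principle, `IsConstructed.induction`.

For a run, let `P` be the integrated potentials. Then `σ_e(t) = σ_e(0) exp (Ψ(P(t))_e - t)` and
`B σ(t) - b` is a multiple of `exp (-t)`, so `P` is a trajectory of an exponential penalty method
for the dual problem (`IsPhysarumRun.exists_isPenaltyPath`). The difference `P(t) - t q` is bounded on
`V(H*)` up to additive constants: on `Ĥ` by an entropy estimate
(`IsPenaltyPath.abs_drop_le_of_mem_optSet`), and on the trajectories because the near-conservation of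
`σ` allows one to follow arcs of large conductivity, as in the `∞`-harmonic case
(`IsPenaltyPath.field_le`). Therefore `σ_e(t)` is comparable to `exp (-(1 - Ψ(q)_e) t)` on `H*` and is
`O(exp (-t))` elsewhere. Finally `p(t) - q` solves Kirchhoff's equations with a source which, away
from the arcs of field larger than `s`, is exponentially smaller than the conductivities of the
arcs of field `s`; testing with a soft thresholding of `p(t) - q` gives exponential decay level by
level (`IsPenaltyPath.expDecay_iff`). The additive constant is fixed by the maximum principle: both
minima are attained on `V(Ĥ)` and equal zero.
-/

namespace TransshipmentProblem

variable {V E : Type*} [Fintype V] (N : TransshipmentProblem V E)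

/-! ### Fields and directed walks -/

lemma field_mul_len (p : V → ℝ) (e : E) :
    N.field p e * N.len e = p (N.tail e) - p (N.head e) := by
  have := (N.len_pos e).ne'
  simp only [field]
  field_simp

lemma field_le_iff (p : V → ℝ) (e : E) (s : ℝ) :
    N.field p e ≤ s ↔ p (N.tail e) - p (N.head e) ≤ s * N.len e := by
  rw [field, div_le_iff₀ (N.len_pos e)]

lemma field_eq_iff (p : V → ℝ) (e : E) (s : ℝ) :
    N.field p e = s ↔ p (N.tail e) - p (N.head e) = s * N.len e := by
  rw [field, div_eq_iff (N.len_pos e).ne']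

variable {N}

lemma tail_mem_verts {H : Set E} {e : E} (he : e ∈ H) : N.tail e ∈ N.verts H :=
  ⟨e, he, Or.inl rfl⟩

lemma head_mem_verts {H : Set E} {e : E} (he : e ∈ H) : N.head e ∈ N.verts H :=
  ⟨e, he, Or.inr rfl⟩

lemma verts_mono {H H' : Set E} (h : H ⊆ H') : N.verts H ⊆ N.verts H' := by
  rintro i ⟨e, he, hi⟩
  exact ⟨e, h he, hi⟩

lemma field_congr {H : Set E} {p q : V → ℝ} (h : Set.EqOn p q (N.verts H)) {e : E}
    (he : e ∈ H) : N.field p e = N.field q e := by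
  rw [field, field, h (tail_mem_verts he), h (head_mem_verts he)]

lemma IsDirWalk.exists_split {π : List E} {a c i : V} (h : N.IsDirWalk π a c)
    (hi : i ∈ π.map N.head) :
    ∃ π₁ π₂, π = π₁ ++ π₂ ∧ π₁ ≠ [] ∧ N.IsDirWalk π₁ a i ∧ N.IsDirWalk π₂ i c := by
  induction π generalizing a with
  | nil => simp at hi
  | cons e π ih =>
    by_cases hie : N.head e = i
    · exact ⟨[e], π, rfl, by simp, ⟨h.1, hie⟩, hie ▸ h.2⟩
    · obtain ⟨π₁, π₂, rfl, -, h₁, h₂⟩ := ih h.2 (by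
        simp only [List.map_cons, List.mem_cons] at hi
        exact hi.resolve_left (Ne.symm hie))
      exact ⟨e :: π₁, π₂, rfl, by simp, ⟨h.1, h₁⟩, h₂⟩

lemma IsDirWalk.exists_split_of_mem_dropLast {π : List E} {a c i : V} (h : N.IsDirWalk π a c)
    (hi : i ∈ (π.map N.head).dropLast) :
    ∃ π₁ π₂, π = π₁ ++ π₂ ∧ π₁ ≠ [] ∧ π₂ ≠ [] ∧ N.IsDirWalk π₁ a i ∧ N.IsDirWalk π₂ i c := by
  induction π generalizing a with
  | nil => simp at hi
  | cons e π ih =>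
    rcases π with _ | ⟨f, π⟩
    · simp at hi
    · by_cases hie : N.head e = i
      · exact ⟨[e], f :: π, rfl, by simp, by simp, ⟨h.1, hie⟩, hie ▸ h.2⟩
      · obtain ⟨π₁, π₂, heq, -, h₂, h₃, h₄⟩ := ih h.2 (by
          simp only [List.map_cons, List.dropLast_cons_cons, List.mem_cons] at hi ⊢
          exact hi.resolve_left (Ne.symm hie))
        exact ⟨e :: π₁, π₂, by rw [heq]; rfl, by simp, h₂, ⟨h.1, h₃⟩, h₄⟩

lemma len_sum_nonneg (N : TransshipmentProblem V E) (π : List E) : 0 ≤ (π.map N.len).sum :=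
  List.sum_nonneg (by
    intro x hx
    obtain ⟨e, -, rfl⟩ := List.mem_map.1 hx
    exact (N.len_pos e).le)

lemma len_sum_pos (N : TransshipmentProblem V E) {π : List E} (h : π ≠ []) :
    0 < (π.map N.len).sum := by
  rcases π with _ | ⟨e, π⟩
  · exact absurd rfl h
  · simpa using add_pos_of_pos_of_nonneg (N.len_pos e) (N.len_sum_nonneg π)

/-- Loop erasure, one loop at a time. -/
lemma IsDirWalk.exists_shorter {π : List E} {a c : V} (h : N.IsDirWalk π a c)
    (hd : ¬ (a :: π.map N.head).Nodup) :
    ∃ π', N.IsDirWalk π' a c ∧ π'.length < π.length ∧ (∀ e ∈ π', e ∈ π) ∧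
      (π'.map N.len).sum ≤ (π.map N.len).sum := by
  induction π generalizing a with
  | nil => simp at hd
  | cons e π ih =>
    by_cases ha : a ∈ (e :: π).map N.head
    · obtain ⟨π₁, π₂, heq, h₁, -, h₂⟩ := h.exists_split ha
      rw [heq]
      refine ⟨π₂, h₂, ?_, fun f hf => List.mem_append_right _ hf, ?_⟩
      · simpa using List.length_pos_of_ne_nil h₁
      · simpa using N.len_sum_nonneg π₁
    · obtain ⟨π', h₁, h₂, h₃, h₄⟩ := ih h.2 (by
        intro hn
        exact hd (List.nodup_cons.2 ⟨ha, by simpa using hn⟩))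
      refine ⟨e :: π', ⟨h.1, h₁⟩, by simpa using h₂, ?_, by simpa using h₄⟩
      intro f hf
      rcases List.mem_cons.1 hf with rfl | hf
      · simp
      · exact List.mem_cons_of_mem _ (h₃ f hf)

lemma IsDirWalk.drop_le {π : List E} {a c : V} (h : N.IsDirWalk π a c) {p : V → ℝ} {s : ℝ}
    (hp : ∀ e ∈ π, N.field p e ≤ s) : p a - p c ≤ s * (π.map N.len).sum := by
  induction π generalizing a with
  | nil =>
    obtain rfl : a = c := h
    simp
  | cons e π ih =>
    have h₁ := ih h.2 fun f hf => hp f (List.mem_cons_of_mem _ hf)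
    have h₂ := (N.field_le_iff p e s).1 (hp e (by simp))
    rw [h.1] at h₂
    simp only [List.map_cons, List.sum_cons]
    linarith

/-- A field bounded by `s` along a walk whose total drop is `s` times its length is equal to `s`
on every arc of the walk. -/
lemma IsDirWalk.field_eq_of_le {π : List E} {a c : V} (h : N.IsDirWalk π a c) {p : V → ℝ} {s : ℝ}
    (hp : ∀ e ∈ π, N.field p e ≤ s) (hs : s * (π.map N.len).sum ≤ p a - p c) :
    ∀ e ∈ π, N.field p e = s := by
  induction π generalizing a with
  | nil => simp
  | cons e π ih =>
    have h₀ : ∀ f ∈ π, N.field p f ≤ s := fun f hf => hp f (List.mem_cons_of_mem _ hf)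
    have h₁ := h.2.drop_le h₀
    have h₂ := (N.field_le_iff p e s).1 (hp e (by simp))
    rw [h.1] at h₂
    simp only [List.map_cons, List.sum_cons] at hs
    intro f hf
    rcases List.mem_cons.1 hf with rfl | hf
    · rw [field_eq_iff, h.1]
      linarith
    · exact ih h.2 h₀ (by linarith) f hf

lemma IsDirWalk.eq_of_field_eq {π : List E} {a c : V} (h : N.IsDirWalk π a c) {p q : V → ℝ}
    (ha : p a = q a) (hf : ∀ e ∈ π, N.field p e = N.field q e) :
    ∀ e ∈ π, p (N.tail e) = q (N.tail e) ∧ p (N.head e) = q (N.head e) := by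
  induction π generalizing a with
  | nil => simp
  | cons e π ih =>
    have h₁ := hf e (by simp)
    rw [field_eq_iff, field_mul_len, h.1] at h₁
    have h₂ : p (N.head e) = q (N.head e) := by linarith
    intro f hf'
    rcases List.mem_cons.1 hf' with rfl | hf'
    · exact ⟨by rw [h.1, ha], h₂⟩
    · exact ih h.2 h₂ (fun f hf'' => hf f (List.mem_cons_of_mem _ hf'')) f hf'

lemma IsDirWalk.exists_tail_eq {π : List E} {a c : V} (h : N.IsDirWalk π a c) {e : E}
    (he : e ∈ π) (hc : N.head e ≠ c) : ∃ f ∈ π, N.tail f = N.head e := by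
  induction π generalizing a with
  | nil => simp at he
  | cons g π ih =>
    rcases List.mem_cons.1 he with rfl | he
    · rcases π with _ | ⟨f, π⟩
      · exact absurd h.2 hc
      · exact ⟨f, by simp, h.2.1⟩
    · obtain ⟨f, hf, hfe⟩ := ih h.2 he
      exact ⟨f, List.mem_cons_of_mem _ hf, hfe⟩

lemma IsDirWalk.exists_head_eq {π : List E} {a c : V} (h : N.IsDirWalk π a c) {e : E}
    (he : e ∈ π) (ha : N.tail e ≠ a) : ∃ f ∈ π, N.head f = N.tail e := by
  induction π generalizing a with
  | nil => simp at he
  | cons g π ih =>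
    rcases List.mem_cons.1 he with rfl | he
    · exact absurd h.1 ha
    · by_cases hg : N.tail e = N.head g
      · exact ⟨g, by simp, hg.symm⟩
      · obtain ⟨f, hf, hfe⟩ := ih h.2 he hg
        exact ⟨f, List.mem_cons_of_mem _ hf, hfe⟩

/-- If the drop of `u` along every arc is at most `K`, then the value of `u` at any vertex of the
walk is controlled, on both sides, by its values at the two ends. -/
lemma IsDirWalk.abs_bound {π : List E} {a c : V} (h : N.IsDirWalk π a c) {u : V → ℝ} {K : ℝ}
    (hK : 0 ≤ K) (hu : ∀ e ∈ π, u (N.tail e) - u (N.head e) ≤ K) :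
    u a - u c ≤ K * π.length ∧ ∀ e ∈ π, u a - u (N.head e) ≤ K * π.length ∧
      u (N.head e) - u c ≤ K * π.length := by
  induction π generalizing a with
  | nil =>
    obtain rfl : a = c := h
    simp
  | cons g π ih =>
    obtain ⟨h₁, h₂⟩ := ih h.2 fun e he => hu e (List.mem_cons_of_mem _ he)
    have h₃ := hu g (by simp)
    rw [h.1] at h₃
    have h₄ : K * (g :: π).length = K * π.length + K := by
      rw [List.length_cons]
      push_cast
      ring
    have h₅ : 0 ≤ K * π.length := by positivity
    rw [h₄]
    refine ⟨by linarith, fun e he => ?_⟩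
    rcases List.mem_cons.1 he with rfl | he
    · exact ⟨by linarith, by linarith⟩
    · obtain ⟨h₆, h₇⟩ := h₂ e he
      exact ⟨by linarith, by linarith⟩

lemma IsDirWalk.forall_head {π : List E} {a c : V} (h : N.IsDirWalk π a c) {G : V → Prop}
    (ha : G a) (hG : ∀ e ∈ π, G (N.tail e) → G (N.head e)) : ∀ e ∈ π, G (N.head e) := by
  induction π generalizing a with
  | nil => simp
  | cons e π ih =>
    have h₁ : G (N.head e) := hG e (by simp) (h.1 ▸ ha)
    intro f hf
    rcases List.mem_cons.1 hf with rfl | hf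
    · exact h₁
    · exact ih h.2 h₁ (fun f hf => hG f (List.mem_cons_of_mem _ hf)) f hf

/-! ### Extending potentials with a bounded field -/

/-- A directed McShane extension: a function on `W` whose drop along every walk of arcs of `A` is
at most `s` times the length extends to all of `V` with field at most `s` on `A`. -/
lemma exists_extension_of_walk_drop_le {A : Set E} {W : Set V} {p : V → ℝ} {s : ℝ} (hs : 0 ≤ s)
    (h : ∀ π a c, N.IsDirWalk π a c → (∀ e ∈ π, e ∈ A) → a ∈ W → c ∈ W →
      p a - p c ≤ s * (π.map N.len).sum) :
    ∃ q : V → ℝ, Set.EqOn q p W ∧ ∀ e ∈ A, N.field q e ≤ s := by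
  -- The cap `M` takes care of vertices from which `W` cannot be reached.
  set M : ℝ := ∑ i, |p i| with hM
  have hpM : ∀ i, |p i| ≤ M := fun i =>
    Finset.single_le_sum (f := fun i => |p i|) (fun _ _ => abs_nonneg _) (Finset.mem_univ i)
  let S : V → Set ℝ := fun i => {x | x = M ∨ ∃ π c, N.IsDirWalk π i c ∧ (∀ e ∈ π, e ∈ A) ∧
    c ∈ W ∧ x = p c + s * (π.map N.len).sum}
  have hne : ∀ i, (S i).Nonempty := fun i => ⟨M, Or.inl rfl⟩
  have hbdd : ∀ i, BddBelow (S i) := by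
    refine fun i => ⟨-M, ?_⟩
    rintro x (rfl | ⟨π, c, -, -, -, rfl⟩)
    · have := (abs_nonneg _).trans (hpM i)
      linarith
    · have h₁ := neg_le_of_abs_le (hpM c)
      have h₂ := mul_nonneg hs (N.len_sum_nonneg π)
      linarith
  refine ⟨fun i => sInf (S i), fun i hi => le_antisymm ?_ ?_, fun e he => ?_⟩
  · exact csInf_le (hbdd i) (Or.inr ⟨[], i, rfl, by simp, hi, by simp⟩)
  · refine le_csInf (hne i) ?_
    rintro x (rfl | ⟨π, c, hπ, hA, hc, rfl⟩)
    · exact le_of_abs_le (hpM i)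
    · linarith [h π i c hπ hA hi hc]
  · rw [field_le_iff]
    have hpos := mul_nonneg hs (N.len_pos e).le
    have : sInf (S (N.tail e)) - s * N.len e ≤ sInf (S (N.head e)) := by
      refine le_csInf (hne _) ?_
      rintro x (rfl | ⟨π, c, hπ, hA, hc, rfl⟩)
      · linarith [csInf_le (hbdd (N.tail e)) (Or.inl rfl)]
      · have := csInf_le (hbdd (N.tail e)) (Or.inr ⟨e :: π, c, ⟨rfl, hπ⟩, by
          simpa using ⟨he, hA⟩, hc, rfl⟩)
        simp only [List.map_cons, List.sum_cons] at this
        linarith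
    linarith

lemma IsTrajectory.ne_nil {H : Set E} {π : List E} {a c : V} (h : N.IsTrajectory H π a c) :
    π ≠ [] := by
  rintro rfl
  simpa using h.new

/-- No arc of a trajectory to `H` belongs to `H`: an inner vertex is incident with each arc,
unless the trajectory is a single arc. -/
lemma IsTrajectory.notMem {H : Set E} {π : List E} {a c : V} (h : N.IsTrajectory H π a c) {e : E}
    (he : e ∈ π) : e ∉ H := by
  intro heH
  obtain ⟨π₁, π₂, rfl⟩ := List.append_of_mem he
  rcases π₂ with _ | ⟨g, π₂⟩
  · rcases List.eq_nil_or_concat π₁ with rfl | ⟨π₁, f, rfl⟩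
    · obtain ⟨f, hf, hfH⟩ := h.new
      simp at hf
      exact hfH (hf ▸ heH)
    · have hw := h.walk
      refine h.internal (N.head f) (by simp [List.dropLast_append_of_ne_nil]) ?_
      have : N.tail e = N.head f := by
        have key : ∀ (π : List E) (a : V), N.IsDirWalk (π ++ [f] ++ [e]) a c →
            N.tail e = N.head f := by
          intro π
          induction π with
          | nil => exact fun a h => h.2.1
          | cons g π ih => exact fun a h => ih _ h.2
        exact key π₁ a (by simpa using hw)
      exact this ▸ tail_mem_verts heH
  · exact h.internal (N.head e) (by simp [List.dropLast_append_of_ne_nil]) (head_mem_verts heH)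

lemma IsTrajectory.slope_mul {H : Set E} {π : List E} {a c : V} (h : N.IsTrajectory H π a c)
    (p : V → ℝ) : N.slope p π a c * (π.map N.len).sum = p a - p c :=
  div_mul_cancel₀ _ (N.len_sum_pos h.ne_nil).ne'

/-- A bound on the slopes of all trajectories bounds the drop along every walk outside `H`: such a
walk splits into trajectories and loops. -/
lemma walk_drop_le_of_slope_le {H : Set E} {p : V → ℝ} {s : ℝ} (hs : 0 ≤ s)
    (h : ∀ π a c, N.IsTrajectory H π a c → N.slope p π a c ≤ s) (π : List E) (a c : V)
    (hw : N.IsDirWalk π a c) (hπ : ∀ e ∈ π, e ∈ Hᶜ) (ha : a ∈ N.verts H) (hc : c ∈ N.verts H) :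
    p a - p c ≤ s * (π.map N.len).sum := by
  induction hn : π.length using Nat.strong_induction_on generalizing π a c with
  | _ n ih =>
    subst hn
    rcases eq_or_ne π [] with rfl | hne
    · obtain rfl : a = c := hw
      simp
    by_cases hint : ∃ i ∈ (π.map N.head).dropLast, i ∈ N.verts H
    · obtain ⟨i, hi, hiH⟩ := hint
      obtain ⟨π₁, π₂, rfl, h₁, h₂, h₃, h₄⟩ := hw.exists_split_of_mem_dropLast hi
      have l₁ := List.length_pos_of_ne_nil h₁
      have l₂ := List.length_pos_of_ne_nil h₂
      have e₁ := ih π₁.length (by simpa using l₂) π₁ a i h₃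
        (fun e he => hπ e (List.mem_append_left _ he)) ha hiH rfl
      have e₂ := ih π₂.length (by simpa using l₁) π₂ i c h₄
        (fun e he => hπ e (List.mem_append_right _ he)) hiH hc rfl
      rw [List.map_append, List.sum_append]
      linarith
    by_cases hnd : (a :: π.map N.head).Nodup
    · have ht : N.IsTrajectory H π a c := by
        refine ⟨hw, hnd, ha, hc, fun i hi hiH => hint ⟨i, hi, hiH⟩, ?_⟩
        obtain ⟨e, he⟩ := List.exists_mem_of_ne_nil π hne
        exact ⟨e, he, hπ e he⟩
      rw [← ht.slope_mul]
      exact mul_le_mul_of_nonneg_right (h π a c ht) (N.len_sum_nonneg π)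
    · obtain ⟨π', h₁, h₂, h₃, h₄⟩ := hw.exists_shorter hnd
      refine (ih π'.length h₂ π' a c h₁ (fun e he => hπ e (h₃ e he)) ha hc rfl).trans ?_
      exact mul_le_mul_of_nonneg_left h₄ hs

/-- If all trajectories to `H` have slope at most `s`, then `p` extends from `V(H)` to a potential
on `V` whose field is at most `s` outside `H`. -/
lemma exists_extension_of_slope_le {H : Set E} {p : V → ℝ} {s : ℝ} (hs : 0 ≤ s)
    (h : ∀ π a c, N.IsTrajectory H π a c → N.slope p π a c ≤ s) :
    ∃ q : V → ℝ, Set.EqOn q p (N.verts H) ∧ ∀ e ∉ H, N.field q e ≤ s :=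
  exists_extension_of_walk_drop_le (A := Hᶜ) hs (walk_drop_le_of_slope_le hs h)

/-- Conversely, such an extension bounds the slopes of all trajectories. -/
lemma IsTrajectory.slope_le {H : Set E} {π : List E} {a c : V} (h : N.IsTrajectory H π a c)
    {p q : V → ℝ} {s : ℝ} (hq : Set.EqOn q p (N.verts H)) (hs : ∀ e ∉ H, N.field q e ≤ s) :
    N.slope p π a c ≤ s := by
  rw [slope, div_le_iff₀ (N.len_sum_pos h.ne_nil), ← hq h.start_mem, ← hq h.end_mem]
  exact h.walk.drop_le fun e he => hs e (h.notMem he)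

lemma exists_isTrajectory_max_slope [Fintype E] {H : Set E} {p : V → ℝ}
    {π₀ : List E} {a₀ c₀ : V} (h₀ : N.IsTrajectory H π₀ a₀ c₀) :
    ∃ π a c, N.IsTrajectory H π a c ∧ ∀ π' a' c', N.IsTrajectory H π' a' c' →
      N.slope p π' a' c' ≤ N.slope p π a c := by
  classical
  let T : Set (List E × V × V) := {x | N.IsTrajectory H x.1 x.2.1 x.2.2}
  have hT : T.Finite := by
    have hfin : {l : List E | l.Nodup}.Finite := by
      have : Finite {l : List E // l.Nodup} := inferInstance
      exact this
    refine (hfin.prod (Set.finite_univ (α := V × V))).subset fun x hx => ⟨?_, trivial⟩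
    exact List.Nodup.of_map _ (List.nodup_cons.1 hx.nodup).2
  obtain ⟨⟨π, a, c⟩, hx, hmax⟩ := hT.exists_maximalFor (fun x => N.slope p x.1 x.2.1 x.2.2) T
    ⟨(π₀, a₀, c₀), h₀⟩
  refine ⟨π, a, c, hx, fun π' a' c' h' => ?_⟩
  by_contra! hlt
  exact absurd (hmax (j := (π', a', c')) h' hlt.le) (not_le.2 hlt)

lemma IsTrajectory.mem_verts_union {H : Set E} {π : List E} {a c : V}
    (h : N.IsTrajectory H π a c) {i : V} (hi : i ∈ N.verts (H ∪ {e | e ∈ π})) :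
    i ∈ N.verts H ∨ ∃ e ∈ π, N.head e = i := by
  obtain ⟨e, he | he, hei⟩ := hi
  · exact Or.inl ⟨e, he, hei⟩
  · rcases hei with rfl | rfl
    · by_cases hta : N.tail e = a
      · exact Or.inl (hta ▸ h.start_mem)
      · exact Or.inr (h.walk.exists_head_eq he hta)
    · exact Or.inr ⟨e, he, rfl⟩

/-- For a trajectory of maximum slope `s ≥ 0`, the extension of `p` to `V` with field at most
`s` outside `H` has field exactly `s` on the trajectory. -/
lemma IsTrajectory.exists_extension {H : Set E} {π : List E} {a c : V} {p : V → ℝ}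
    (h : N.IsTrajectory H π a c) (hs : 0 ≤ N.slope p π a c)
    (hmax : ∀ π' a' c', N.IsTrajectory H π' a' c' → N.slope p π' a' c' ≤ N.slope p π a c) :
    ∃ q : V → ℝ, Set.EqOn q p (N.verts H) ∧ (∀ e ∉ H, N.field q e ≤ N.slope p π a c) ∧
      ∀ e ∈ π, N.field q e = N.slope p π a c := by
  obtain ⟨q, hq, hqs⟩ := exists_extension_of_slope_le hs hmax
  refine ⟨q, hq, hqs, h.walk.field_eq_of_le (fun e he => hqs e (h.notMem he)) ?_⟩
  rw [h.slope_mul, hq h.start_mem, hq h.end_mem]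

lemma IsTrajectory.eqOn_union {H : Set E} {π : List E} {a c : V} {p q : V → ℝ}
    (h : N.IsTrajectory H π a c) (hpq : Set.EqOn p q (N.verts H))
    (hf : ∀ e ∈ π, N.field p e = N.field q e) :
    Set.EqOn p q (N.verts (H ∪ {e | e ∈ π})) := by
  intro i hi
  rcases h.mem_verts_union hi with hi | ⟨e, he, rfl⟩
  · exact hpq hi
  · exact (h.walk.eq_of_field_eq (hpq h.start_mem) hf e he).2

/-! ### Following arcs of large weight -/

/-- Starting with an arc of large weight `x`, follow arcs, losing at most `δ` of weight per step.
Since `f` decreases strictly along arcs of weight above `r`, fewer than `card V` steps are made, and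
the walk ends in `W`. As `u` does not increase along the way, its value at the end is at most
its value at the beginning.  Applied with `tl`, `hd` exchanged and `f`, `u` negated, this also
follows arcs backwards. -/
lemma exists_mem_le_of_follow {α β : Type*} [Fintype α] {tl hd : β → α} {x : β → ℝ} {f u : α → ℝ}
    {W : Set α} {A : Set β} {δ r : ℝ} (hδ : 0 ≤ δ)
    (hf : ∀ e ∈ A, r < x e → f (hd e) < f (tl e))
    (hu : ∀ e ∈ A, tl e ∉ W → r < x e → u (hd e) ≤ u (tl e))
    (hstep : ∀ e ∈ A, hd e ∉ W → r < x e → ∃ e' ∈ A, tl e' = hd e ∧ x e - δ ≤ x e')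
    {e : β} (he : e ∈ A) (hx : r + δ * Fintype.card α < x e) : ∃ c ∈ W, u c ≤ u (hd e) := by
  classical
  have key : ∀ n : ℕ, ∀ e ∈ A, (Finset.univ.filter fun v => f v < f (hd e)).card < n →
      r + δ * n < x e → ∃ c ∈ W, u c ≤ u (hd e) := by
    intro n
    induction n with
    | zero => exact fun e _ hn => absurd hn (Nat.not_lt_zero _)
    | succ n ih =>
      intro e he hn hx
      by_cases hW : hd e ∈ W
      · exact ⟨_, hW, le_rfl⟩
      push_cast at hx
      have hδn : 0 ≤ δ * n := by positivity
      obtain ⟨e', he', htl, hxe'⟩ := hstep e he hW (by linarith)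
      have hr' : r < x e' := by linarith
      have hlt := hf e' he' hr'
      have hcard : (Finset.univ.filter fun v => f v < f (hd e')).card <
          (Finset.univ.filter fun v => f v < f (hd e)).card := by
        refine Finset.card_lt_card (Finset.ssubset_iff_of_subset ?_ |>.2 ⟨hd e', ?_, ?_⟩)
        · intro v hv
          rw [Finset.mem_filter] at hv ⊢
          exact ⟨hv.1, hv.2.trans (htl ▸ hlt)⟩
        · simpa using htl ▸ hlt
        · simp
      obtain ⟨c, hc, hcu⟩ := ih e' he' (by omega) (by linarith)
      exact ⟨c, hc, hcu.trans (htl ▸ hu e' he' (htl ▸ hW) hr')⟩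
  refine key _ e he ?_ hx
  exact Finset.card_lt_univ_of_notMem (x := hd e) (by simp)

/-! ### Comparison with infinity-harmonic potentials -/

/-- Let `q` have field at most `s` outside `H`. An `∞`-harmonic potential `p'` on `H'` that agrees
with `q` on `V(H)` has field at most `s` on `H' ∖ H`: following an arc of larger field in both
directions, one arrives in `V(H)`, while `p' - q` decreases along the way. -/
lemma IsInfHarmonic.field_le {H H' : Set E} {S : Set V} {p' q : V → ℝ} {s : ℝ} (hs : 0 ≤ s)
    (hp' : N.IsInfHarmonic H' S p') (hS : S ⊆ N.verts H) (hq : ∀ e ∉ H, N.field q e ≤ s)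
    (hpq : Set.EqOn p' q (N.verts H)) {e : E} (he : e ∈ H') (heH : e ∉ H) :
    N.field p' e ≤ s := by
  by_contra! hlt
  have hdec : ∀ e, s < N.field p' e → p' (N.head e) < p' (N.tail e) := fun e hs' => by
    have h₁ := N.field_mul_len p' e
    have h₂ := mul_pos (hs.trans_lt hs') (N.len_pos e)
    linarith
  have hu : ∀ e ∉ H, s < N.field p' e →
      p' (N.head e) - q (N.head e) < p' (N.tail e) - q (N.tail e) := fun e he hs' => by
    have h₁ := N.field_mul_len p' e
    have h₂ := (N.field_le_iff q e s).1 (hq e he)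
    have h₃ := mul_lt_mul_of_pos_right hs' (N.len_pos e)
    linarith
  obtain ⟨c, hc, hcu⟩ := exists_mem_le_of_follow (tl := N.tail) (hd := N.head) (x := N.field p')
    (f := p') (u := fun i => p' i - q i) (W := N.verts H) (A := H') (δ := 0) (r := s) le_rfl
    (fun e _ => hdec e)
    (fun e _ ht h => (hu e (fun heH => ht (tail_mem_verts heH)) h).le)
    (fun e he hW _ => by
      obtain ⟨r, -, h₁, ⟨f, ⟨hf, hfi⟩, hfr⟩, -⟩ :=
        hp' (N.head e) (head_mem_verts he) fun h => hW (hS h)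
      refine ⟨f, hf, hfi, ?_⟩
      rw [hfr, sub_zero]
      exact h₁.2 ⟨e, ⟨he, rfl⟩, rfl⟩) he (by simpa using hlt)
  obtain ⟨a, ha, hau⟩ := exists_mem_le_of_follow (tl := N.head) (hd := N.tail) (x := N.field p')
    (f := fun i => - p' i) (u := fun i => - (p' i - q i)) (W := N.verts H) (A := H') (δ := 0)
    (r := s) le_rfl
    (fun e _ h => neg_lt_neg (hdec e h))
    (fun e _ ht h => neg_le_neg (hu e (fun heH => ht (head_mem_verts heH)) h).le)
    (fun e he hW _ => by
      obtain ⟨r, -, ⟨⟨f, ⟨hf, hfi⟩, hfr⟩, -⟩, h₁⟩ :=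
        hp' (N.tail e) (tail_mem_verts he) fun h => hW (hS h)
      refine ⟨f, hf, hfi, ?_⟩
      rw [hfr, sub_zero]
      exact h₁.2 ⟨e, ⟨he, rfl⟩, rfl⟩) he (by simpa using hlt)
  have h₁ := hu e heH hlt
  have h₂ := hpq hc
  have h₃ := hpq ha
  linarith

lemma IsInfHarmonic.field_le_slope {H H' : Set E} {S : Set V} {p p' : V → ℝ} {π : List E} {a c : V}
    (hp' : N.IsInfHarmonic H' S p') (hS : S ⊆ N.verts H) (hpp : Set.EqOn p' p (N.verts H))
    (ht : N.IsTrajectory H π a c) (hpos : 0 < N.slope p π a c)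
    (hmax : ∀ π' a' c', N.IsTrajectory H π' a' c' → N.slope p π' a' c' ≤ N.slope p π a c)
    {e : E} (he : e ∈ H') (heH : e ∉ H) : N.field p' e ≤ N.slope p π a c := by
  obtain ⟨q, hq, hqs, -⟩ := ht.exists_extension hpos.le hmax
  exact hp'.field_le hpos.le hS hqs (fun i hi => (hpp hi).trans (hq hi).symm) he heH

/-- A trajectory of maximum slope to `H` is contained in every `∞`-harmonic extension whose field is
nonpositive on the remaining arcs of the trajectory. -/
lemma IsInfHarmonic.mem_and_field_eq {H H' : Set E} {S : Set V} {p p' : V → ℝ} {π : List E}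
    {a c : V} (hp' : N.IsInfHarmonic H' S p') (hS : S ⊆ N.verts H)
    (hpp : Set.EqOn p' p (N.verts H))
    (ht : N.IsTrajectory H π a c) (hpos : 0 < N.slope p π a c)
    (hmax : ∀ π' a' c', N.IsTrajectory H π' a' c' → N.slope p π' a' c' ≤ N.slope p π a c)
    (hπ : ∀ e ∈ π, e ∈ H' ∨ N.field p' e ≤ 0) :
    ∀ e ∈ π, e ∈ H' ∧ N.field p' e = N.slope p π a c := by
  have hle : ∀ e ∈ π, N.field p' e ≤ N.slope p π a c := fun e he => by
    rcases hπ e he with h | h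
    · exact hp'.field_le_slope hS hpp ht hpos hmax h (ht.notMem he)
    · exact h.trans hpos.le
  have heq := ht.walk.field_eq_of_le hle (by
    rw [ht.slope_mul, hpp ht.start_mem, hpp ht.end_mem])
  refine fun e he => ⟨(hπ e he).resolve_right fun h => ?_, heq e he⟩
  rw [heq e he] at h
  exact absurd hpos (not_lt.2 h)

lemma IsInfHarmonic.congr {H : Set E} {S : Set V} {p q : V → ℝ} (hp : N.IsInfHarmonic H S p)
    (h : Set.EqOn q p (N.verts H)) : N.IsInfHarmonic H S q := by
  intro i hi hiS
  obtain ⟨r, hr, h₁, h₂⟩ := hp i hi hiS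
  have himg : ∀ T ⊆ H, N.field q '' T = N.field p '' T := fun T hT =>
    Set.image_congr fun e he => field_congr h (hT he)
  refine ⟨r, hr, ?_, ?_⟩
  · rwa [himg _ fun e he => he.1]
  · rwa [himg _ fun e he => he.1]

end TransshipmentProblem

namespace TransshipmentProblem

variable {V E : Type*} [Fintype V] {N : TransshipmentProblem V E}

/-! ### Propagation along connected subgraphs -/

lemma ConnectedSub.induction {H : Set E} (hH : N.ConnectedSub H) {G : V → Prop}
    (hG : ∀ e ∈ H, G (N.tail e) ↔ G (N.head e)) {i j : V} (hi : i ∈ N.verts H)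
    (hj : j ∈ N.verts H) (h : G i) : G j := by
  obtain ⟨w⟩ := hH.preconnected ⟨i, hi⟩ ⟨j, hj⟩
  have key : ∀ {x y : N.verts H}, ((SimpleGraph.fromRel fun i j => ∃ e ∈ H, N.tail e = i ∧
      N.head e = j).induce (N.verts H)).Walk x y → G x → G y := by
    intro x y w
    induction w with
    | nil => exact id
    | cons hadj _ ih =>
      intro hx
      refine ih ?_
      obtain ⟨-, ⟨e, he, h₁, h₂⟩ | ⟨e, he, h₁, h₂⟩⟩ := hadj <;>
        simp only [Function.Embedding.subtype_apply] at h₁ h₂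
      · exact h₂ ▸ (hG e he).1 (h₁ ▸ hx)
      · exact h₁ ▸ (hG e he).2 (h₂ ▸ hx)
  exact key w h

lemma ConnectedSub.nonempty_verts {H : Set E} (hH : N.ConnectedSub H) : (N.verts H).Nonempty := by
  obtain ⟨i⟩ := hH.nonempty
  exact ⟨i, i.2⟩

lemma induction_of_connected (N : TransshipmentProblem V E) {G : V → Prop}
    (hG : ∀ e, G (N.tail e) ↔ G (N.head e)) {i : V} (h : G i) (j : V) : G j := by
  obtain ⟨w⟩ := N.connected.preconnected i j
  have key : ∀ {x y : V}, (SimpleGraph.fromRel fun i j => ∃ e, N.tail e = i ∧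
      N.head e = j).Walk x y → G x → G y := by
    intro x y w
    induction w with
    | nil => exact id
    | cons hadj _ ih =>
      intro hx
      refine ih ?_
      obtain ⟨-, ⟨e, h₁, h₂⟩ | ⟨e, h₁, h₂⟩⟩ := hadj
      · exact h₂ ▸ (hG e).1 (h₁ ▸ hx)
      · exact h₁ ▸ (hG e).2 (h₂ ▸ hx)
  exact key w h

/-! ### Boundaries, flows and the optimal set -/

variable [Fintype E]

lemma IsDirWalk.exists_flow {π : List E} {a c : V} (h : N.IsDirWalk π a c) :
    ∃ x : E → ℝ, (∀ e, 0 ≤ x e) ∧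
      (∀ u : V → ℝ, ∑ e, x e * (u (N.tail e) - u (N.head e)) = u a - u c) ∧
      N.cost x = (π.map N.len).sum := by
  classical
  induction π generalizing a with
  | nil =>
    obtain rfl : a = c := h
    exact ⟨0, by simp, by simp, by simp [cost]⟩
  | cons e π ih =>
    obtain ⟨x, hx, hu, hc⟩ := ih h.2
    refine ⟨fun f => x f + if f = e then 1 else 0, fun f => ?_, fun u => ?_, ?_⟩
    · have := hx f
      dsimp only
      split_ifs <;> linarith
    · simp only [add_mul, Finset.sum_add_distrib, hu]
      simp [h.1]
    · simp only [cost, mul_add, Finset.sum_add_distrib] at hc ⊢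
      rw [hc]
      simp [add_comm]

variable [DecidableEq V]

lemma boundary_mulVec_apply (N : TransshipmentProblem V E) (x : E → ℝ) (i : V) :
    N.boundary.mulVec x i =
      ∑ e, (if N.tail e = i then x e else 0) - ∑ e, (if N.head e = i then x e else 0) := by
  rw [Matrix.mulVec, dotProduct, ← Finset.sum_sub_distrib]
  refine Finset.sum_congr rfl fun e _ => ?_
  have := N.loopless e
  simp only [boundary, eq_comm (a := i)]
  split_ifs with h₁ h₂ <;> simp_all

lemma sum_boundary_mulVec_mul (N : TransshipmentProblem V E) (x : E → ℝ) (u : V → ℝ) :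
    ∑ i, N.boundary.mulVec x i * u i = ∑ e, x e * (u (N.tail e) - u (N.head e)) := by
  simp only [boundary_mulVec_apply, sub_mul, Finset.sum_mul, Finset.sum_sub_distrib]
  rw [Finset.sum_comm, Finset.sum_comm (s := Finset.univ (α := V)), ← Finset.sum_sub_distrib]
  refine Finset.sum_congr rfl fun e _ => ?_
  simp [ite_mul, mul_sub]

lemma boundary_mulVec_eq_iff {x : E → ℝ} {β : V → ℝ} :
    N.boundary.mulVec x = β ↔
      ∀ u : V → ℝ, ∑ e, x e * (u (N.tail e) - u (N.head e)) = ∑ i, β i * u i := by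
  refine ⟨fun h u => by rw [← sum_boundary_mulVec_mul, h], fun h => funext fun i => ?_⟩
  have := h (Pi.single i 1)
  rw [← sum_boundary_mulVec_mul] at this
  simpa [Pi.single_apply] using this

lemma exists_out_arc {x : E → ℝ} {e : E} {m : ℝ} (hx : ∀ f, 0 ≤ x f) (hm : 0 < m)
    (h : Fintype.card E * m ≤ x e + N.boundary.mulVec x (N.head e)) :
    ∃ f, N.tail f = N.head e ∧ m ≤ x f := by
  have h₁ : x e ≤ ∑ f, (if N.head f = N.head e then x f else 0) := by
    have := Finset.single_le_sum (f := fun f => if N.head f = N.head e then x f else 0)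
      (fun f _ => by split_ifs <;> simp [hx f]) (Finset.mem_univ e)
    simpa using this
  have h₂ : ∑ _f : E, m ≤ ∑ f, (if N.tail f = N.head e then x f else 0) := by
    rw [boundary_mulVec_apply] at h
    simp only [Finset.sum_const, Finset.card_univ, nsmul_eq_mul]
    linarith
  obtain ⟨f, -, hf⟩ := Finset.exists_le_of_sum_le ⟨e, Finset.mem_univ e⟩ h₂
  split_ifs at hf with hfe
  · exact ⟨f, hfe, hf⟩
  · exact absurd hf (not_le.2 hm)

lemma exists_in_arc {x : E → ℝ} {e : E} {m : ℝ} (hx : ∀ f, 0 ≤ x f) (hm : 0 < m)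
    (h : Fintype.card E * m ≤ x e - N.boundary.mulVec x (N.tail e)) :
    ∃ f, N.head f = N.tail e ∧ m ≤ x f := by
  have h₁ : x e ≤ ∑ f, (if N.tail f = N.tail e then x f else 0) := by
    have := Finset.single_le_sum (f := fun f => if N.tail f = N.tail e then x f else 0)
      (fun f _ => by split_ifs <;> simp [hx f]) (Finset.mem_univ e)
    simpa using this
  have h₂ : ∑ _f : E, m ≤ ∑ f, (if N.head f = N.tail e then x f else 0) := by
    rw [boundary_mulVec_apply] at h
    simp only [Finset.sum_const, Finset.card_univ, nsmul_eq_mul]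
    linarith
  obtain ⟨f, -, hf⟩ := Finset.exists_le_of_sum_le ⟨e, Finset.mem_univ e⟩ h₂
  split_ifs at hf with hfe
  · exact ⟨f, hfe, hf⟩
  · exact absurd hf (not_le.2 hm)

lemma IsOptFlow.eq_zero {φ : E → ℝ} (h : N.IsOptFlow φ) {e : E} (he : e ∉ N.optSet) : φ e = 0 := by
  by_contra hne
  exact he ⟨φ, h, hne⟩

lemma IsOptFlow.midpoint {φ ψ : E → ℝ} (hφ : N.IsOptFlow φ) (hψ : N.IsOptFlow ψ) :
    N.IsOptFlow fun e => (φ e + ψ e) / 2 := by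
  refine ⟨⟨boundary_mulVec_eq_iff.2 fun u => ?_, fun e => ?_⟩, fun χ hχ => ?_⟩
  · have h₁ := boundary_mulVec_eq_iff.1 hφ.1.1 u
    have h₂ := boundary_mulVec_eq_iff.1 hψ.1.1 u
    have h₃ : ∑ e, (φ e + ψ e) / 2 * (u (N.tail e) - u (N.head e)) =
        (∑ e, φ e * (u (N.tail e) - u (N.head e)) +
          ∑ e, ψ e * (u (N.tail e) - u (N.head e))) / 2 := by
      rw [← Finset.sum_add_distrib, Finset.sum_div]
      exact Finset.sum_congr rfl fun e _ => by ring
    rw [h₃, h₁, h₂]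
    ring
  · have h₁ := hφ.1.2 e
    have h₂ := hψ.1.2 e
    positivity
  · have h₁ := hφ.2 χ hχ
    have h₂ := hψ.2 χ hχ
    have h₃ : N.cost (fun e => (φ e + ψ e) / 2) = (N.cost φ + N.cost ψ) / 2 := by
      simp only [cost]
      rw [← Finset.sum_add_distrib, Finset.sum_div]
      exact Finset.sum_congr rfl fun e _ => by ring
    rw [h₃]
    linarith

/-- Averages of optimal flows are optimal, so that some optimal flow is positive on all of `Ĥ`. -/
lemma exists_optFlow_pos (hne : N.optSet.Nonempty) :
    ∃ φ, N.IsOptFlow φ ∧ ∀ e ∈ N.optSet, 0 < φ e := by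
  classical
  have key : ∀ S : Finset E, ∃ φ, N.IsOptFlow φ ∧ ∀ e ∈ S, e ∈ N.optSet → 0 < φ e := by
    intro S
    induction S using Finset.induction_on with
    | empty =>
      obtain ⟨e, φ, hφ, -⟩ := hne
      exact ⟨φ, hφ, by simp⟩
    | insert f S _ ih =>
      obtain ⟨φ, hφ, hS⟩ := ih
      by_cases hf : f ∈ N.optSet
      · obtain ⟨ψ, hψ, hψf⟩ := hf
        have hpos : 0 < ψ f := (hψ.1.2 f).lt_of_ne hψf.symm
        refine ⟨_, hφ.midpoint hψ, fun e he heo => ?_⟩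
        have h₁ := hφ.1.2 e
        have h₂ := hψ.1.2 e
        rcases Finset.mem_insert.1 he with rfl | he
        · positivity
        · have := hS e he heo
          positivity
      · refine ⟨φ, hφ, fun e he heo => ?_⟩
        rcases Finset.mem_insert.1 he with rfl | he
        · exact absurd heo hf
        · exact hS e he heo
  obtain ⟨φ, hφ, h⟩ := key Finset.univ
  exact ⟨φ, hφ, fun e he => h e (Finset.mem_univ e) he⟩

lemma b_eq_zero_of_notMem_verts (hne : N.optSet.Nonempty) {i : V}
    (hi : i ∉ N.verts N.optSet) : N.b i = 0 := by
  obtain ⟨φ, hφ, -⟩ := exists_optFlow_pos hne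
  rw [← hφ.1.1, boundary_mulVec_apply, ← Finset.sum_sub_distrib]
  refine Finset.sum_eq_zero fun e _ => ?_
  by_cases he : e ∈ N.optSet
  · rw [if_neg, if_neg, sub_zero]
    · rintro rfl
      exact hi (head_mem_verts he)
    · rintro rfl
      exact hi (tail_mem_verts he)
  · simp [hφ.eq_zero he]

/-- Optimality of the flows on `Ĥ`: a circulation that is nonnegative outside `Ĥ` can be added, with
a small weight, to an optimal flow that is positive on all of `Ĥ`. -/
lemma circulation_cost_nonneg (hne : N.optSet.Nonempty) {ψ : E → ℝ}
    (h₀ : ∀ u : V → ℝ, ∑ e, ψ e * (u (N.tail e) - u (N.head e)) = 0)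
    (hψ : ∀ e ∉ N.optSet, 0 ≤ ψ e) : 0 ≤ N.cost ψ := by
  obtain ⟨φ, hφ, hpos⟩ := exists_optFlow_pos hne
  obtain ⟨ε, hε, hle⟩ : ∃ ε > 0, ∀ e, 0 ≤ φ e + ε * ψ e := by
    have : ∀ᶠ ε in nhdsWithin (0 : ℝ) (Set.Ioi 0), ∀ e, 0 ≤ φ e + ε * ψ e := by
      rw [eventually_all]
      intro e
      by_cases he : e ∈ N.optSet
      · have hc : Continuous fun ε : ℝ => φ e + ε * ψ e := by fun_prop
        have := hc.tendsto 0
        simp only [zero_mul, add_zero] at this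
        filter_upwards [nhdsWithin_le_nhds (this.eventually (lt_mem_nhds (hpos e he)))] with ε h
        exact h.le
      · filter_upwards [self_mem_nhdsWithin] with ε hε
        exact add_nonneg (hφ.1.2 e) (mul_nonneg (le_of_lt hε) (hψ e he))
    obtain ⟨ε, h₁, h₂⟩ := (this.and self_mem_nhdsWithin).exists
    exact ⟨ε, h₂, h₁⟩
  have hflow : N.IsPosFlow fun e => φ e + ε * ψ e := by
    refine ⟨boundary_mulVec_eq_iff.2 fun u => ?_, hle⟩
    rw [← boundary_mulVec_eq_iff.1 hφ.1.1 u]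
    have h₁ := h₀ u
    simp only [add_mul, Finset.sum_add_distrib, mul_assoc, ← Finset.mul_sum, h₁]
    simp
  have h₁ := hφ.2 _ hflow
  have h₂ : N.cost (fun e => φ e + ε * ψ e) = N.cost φ + ε * N.cost ψ := by
    simp only [cost, mul_add, Finset.sum_add_distrib, Finset.mul_sum]
    congr 1
    exact Finset.sum_congr rfl fun e _ => by ring
  rw [h₂] at h₁
  exact nonneg_of_mul_nonneg_right (by linarith) hε

/-- If `Ĥ` is connected, then a dual optimal potential exists whose restriction to `V(Ĥ)` is the
potential of the optimal set. On `V(Ĥ)`, its value at `i` is the cost of a signed unit flow in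
`Ĥ` from `i` to a fixed root; optimality bounds its drop along all directed walks, so that it
extends to `V`. -/
lemma exists_isOptPotential_field_le_one (hconn : N.ConnectedSub N.optSet) :
    ∃ q : V → ℝ, N.IsOptPotential q ∧ ∀ e, N.field q e ≤ 1 := by
  classical
  obtain ⟨r, hr⟩ := hconn.nonempty_verts
  have hne : N.optSet.Nonempty := ⟨_, hr.choose_spec.1⟩
  have hx : ∀ i ∈ N.verts N.optSet, ∃ x : E → ℝ, (∀ e ∉ N.optSet, x e = 0) ∧
      ∀ u : V → ℝ, ∑ e, x e * (u (N.tail e) - u (N.head e)) = u i - u r := by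
    intro i hi
    refine hconn.induction (G := fun i => ∃ x : E → ℝ, (∀ e ∉ N.optSet, x e = 0) ∧
      ∀ u : V → ℝ, ∑ e, x e * (u (N.tail e) - u (N.head e)) = u i - u r) ?_ hr hi
      ⟨0, by simp, by simp⟩
    refine fun e he => ⟨?_, ?_⟩
    · rintro ⟨x, h₁, h₂⟩
      refine ⟨fun f => x f - if f = e then 1 else 0, fun f hf => ?_, fun u => ?_⟩
      · dsimp only
        rw [h₁ f hf, if_neg, sub_zero]
        rintro rfl
        exact hf he
      · simp only [sub_mul, Finset.sum_sub_distrib, h₂]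
        simp
    · rintro ⟨x, h₁, h₂⟩
      refine ⟨fun f => x f + if f = e then 1 else 0, fun f hf => ?_, fun u => ?_⟩
      · dsimp only
        rw [h₁ f hf, if_neg, add_zero]
        rintro rfl
        exact hf he
      · simp only [add_mul, Finset.sum_add_distrib, h₂]
        simp
  choose! x hx₀ hxu using hx
  have hdrop : ∀ i j π, i ∈ N.verts N.optSet → j ∈ N.verts N.optSet → N.IsDirWalk π i j →
      N.cost (x i) - N.cost (x j) ≤ 1 * (π.map N.len).sum := by
    intro i j π hi hj hπ
    obtain ⟨y, hy, hyu, hyc⟩ := hπ.exists_flow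
    have := circulation_cost_nonneg (ψ := fun e => x j e + y e - x i e) hne (fun u => by
      simp only [sub_mul, add_mul, Finset.sum_sub_distrib, Finset.sum_add_distrib, hxu i hi,
        hxu j hj, hyu]
      ring) (fun e he => by simp [hx₀ i hi e he, hx₀ j hj e he, hy e])
    simp only [cost, mul_sub, mul_add, Finset.sum_sub_distrib, Finset.sum_add_distrib] at this hyc ⊢
    linarith
  obtain ⟨q, hqW, hq⟩ := exists_extension_of_walk_drop_le (N := N) (A := Set.univ)
    (W := N.verts N.optSet) (p := fun i => N.cost (x i)) zero_le_one
    (fun π a c hπ _ ha hc => hdrop a c π ha hc hπ)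
  have hq₁ : ∀ e ∈ N.optSet, N.field q e = 1 := by
    intro e he
    refine le_antisymm (hq e trivial) ?_
    have hi := tail_mem_verts (N := N) he
    have hj := head_mem_verts (N := N) he
    have := circulation_cost_nonneg
      (ψ := fun f => x (N.tail e) f - x (N.head e) f - if f = e then 1 else 0) hne (fun u => by
      simp only [sub_mul, Finset.sum_sub_distrib, hxu _ hi, hxu _ hj]
      simp) (fun f hf => by
        rw [hx₀ _ hi f hf, hx₀ _ hj f hf, if_neg]
        · simp
        · rintro rfl
          exact hf he)
    have h₃ : N.cost (fun f => x (N.tail e) f - x (N.head e) f - if f = e then 1 else 0) =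
        N.cost (x (N.tail e)) - N.cost (x (N.head e)) - N.len e := by
      simp [cost, mul_sub, Finset.sum_sub_distrib]
    rw [field, le_div_iff₀ (N.len_pos e), hqW hi, hqW hj]
    linarith
  obtain ⟨k, hk, hmin⟩ := (Set.toFinite (N.verts N.optSet)).exists_minimalFor q _ ⟨r, hr⟩
  refine ⟨fun i => q i - q k, ⟨fun e he => ?_, ⟨k, hk, by simp⟩, ?_⟩, fun e => ?_⟩
  · rw [← hq₁ e he]
    simp [field]
  · rintro _ ⟨i, hi, rfl⟩
    rcases le_total (q i) (q k) with h | h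
    · simpa using hmin hi h
    · simpa using h
  · have := hq e trivial
    simpa [field] using this

lemma IsOptPotential.congr {p q : V → ℝ} (hp : N.IsOptPotential p)
    (h : Set.EqOn q p (N.verts N.optSet)) : N.IsOptPotential q :=
  ⟨fun e he => by rw [field_congr h he, hp.1 e he], by rw [h.image_eq]; exact hp.2⟩

lemma IsOptPotential.eqOn {p q : V → ℝ} (hconn : N.ConnectedSub N.optSet)
    (hp : N.IsOptPotential p) (hq : N.IsOptPotential q) :
    Set.EqOn p q (N.verts N.optSet) := by
  obtain ⟨r, hr⟩ := hconn.nonempty_verts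
  have hconst : ∀ i ∈ N.verts N.optSet, p i - q i = p r - q r := fun i hi =>
    hconn.induction (G := fun i => p i - q i = p r - q r) (fun e he => by
      have h₁ := (N.field_eq_iff p e 1).1 (hp.1 e he)
      have h₂ := (N.field_eq_iff q e 1).1 (hq.1 e he)
      constructor <;> intro h <;> linarith) hr hi rfl
  obtain ⟨⟨i, hi, hpi⟩, hpm⟩ := hp.2
  obtain ⟨⟨j, hj, hqj⟩, hqm⟩ := hq.2
  have h₁ := hqm ⟨i, hi, rfl⟩
  have h₂ := hpm ⟨j, hj, rfl⟩
  have h₃ := hconst i hi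
  have h₄ := hconst j hj
  intro k hk
  have h₅ := hconst k hk
  linarith

/-- Complementary slackness. -/
lemma isDualOptimal_of_field (hne : N.optSet.Nonempty) {q : V → ℝ} (hq : ∀ e, N.field q e ≤ 1)
    (hq₁ : ∀ e ∈ N.optSet, N.field q e = 1) : N.IsDualOptimal q := by
  obtain ⟨φ, hφ, -⟩ := exists_optFlow_pos hne
  refine ⟨fun e => by simpa using (N.field_le_iff q e 1).1 (hq e), fun q' hq' => ?_⟩
  have h : ∀ u : V → ℝ, ∑ i, u i * N.b i = ∑ e, φ e * (u (N.tail e) - u (N.head e)) := by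
    intro u
    rw [boundary_mulVec_eq_iff.1 hφ.1.1 u]
    exact Finset.sum_congr rfl fun i _ => mul_comm _ _
  rw [h, h]
  refine Finset.sum_le_sum fun e _ => ?_
  by_cases he : e ∈ N.optSet
  · rw [(N.field_eq_iff q e 1).1 (hq₁ e he), one_mul]
    exact mul_le_mul_of_nonneg_left (hq' e) (hφ.1.2 e)
  · simp [hφ.eq_zero he]

end TransshipmentProblem

namespace TransshipmentProblem

variable {V E : Type*} [Fintype V] [Fintype E] [DecidableEq V]
  {N : TransshipmentProblem V E}

/-! ### The construction of the limit potential -/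

/-- The invariant of the construction, where `s` is the slope of the last trajectory that was
added (`1` in the beginning): the potential of `H` extends to `V` with field at most `s` outside
`H`, and at the vertices outside the support of `b` the ingoing and outgoing maxima of the field
agree and are at least `s`. -/
structure ConstructionInvariant (N : TransshipmentProblem V E) (H : Set E) (p : V → ℝ)
    (s : ℝ) : Prop where
  optSet_subset : N.optSet ⊆ H
  isOptPotential : N.IsOptPotential p
  exists_extension : ∃ q : V → ℝ, Set.EqOn q p (N.verts H) ∧ ∀ e ∉ H, N.field q e ≤ s
  harmonic : ∀ i ∈ N.verts H, i ∉ Function.support N.b → ∃ r, s ≤ r ∧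
    IsGreatest (N.field p '' {e | e ∈ H ∧ N.head e = i}) r ∧
    IsGreatest (N.field p '' {e | e ∈ H ∧ N.tail e = i}) r
  field_le_one : ∀ e ∈ H, N.field p e ≤ 1
  le_one : s ≤ 1

lemma exists_head_eq_of_mem_optSet {e : E} (he : e ∈ N.optSet) (hb : N.b (N.tail e) = 0) :
    ∃ f ∈ N.optSet, N.head f = N.tail e := by
  obtain ⟨φ, hφ, hne⟩ := he
  have hpos : 0 < φ e := (hφ.1.2 e).lt_of_ne hne.symm
  have hE : 0 < (Fintype.card E : ℝ) := by
    have : Nonempty E := ⟨e⟩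
    exact_mod_cast Fintype.card_pos
  obtain ⟨f, hf, hφf⟩ := exists_in_arc (N := N) (e := e) hφ.1.2 (div_pos hpos hE) (by
    rw [hφ.1.1, hb, mul_div_cancel₀ _ hE.ne', sub_zero])
  exact ⟨f, ⟨φ, hφ, ((div_pos hpos hE).trans_le hφf).ne'⟩, hf⟩

lemma exists_tail_eq_of_mem_optSet {e : E} (he : e ∈ N.optSet) (hb : N.b (N.head e) = 0) :
    ∃ f ∈ N.optSet, N.tail f = N.head e := by
  obtain ⟨φ, hφ, hne⟩ := he
  have hpos : 0 < φ e := (hφ.1.2 e).lt_of_ne hne.symm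
  have hE : 0 < (Fintype.card E : ℝ) := by
    have : Nonempty E := ⟨e⟩
    exact_mod_cast Fintype.card_pos
  obtain ⟨f, hf, hφf⟩ := exists_out_arc (N := N) (e := e) hφ.1.2 (div_pos hpos hE) (by
    rw [hφ.1.1, hb, mul_div_cancel₀ _ hE.ne', add_zero])
  exact ⟨f, ⟨φ, hφ, ((div_pos hpos hE).trans_le hφf).ne'⟩, hf⟩

lemma constructionInvariant_optSet (hconn : N.ConnectedSub N.optSet) {p : V → ℝ}
    (hp : N.IsOptPotential p) : N.ConstructionInvariant N.optSet p 1 := by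
  obtain ⟨q, hq, hq₁⟩ := exists_isOptPotential_field_le_one hconn
  refine ⟨subset_rfl, hp, ⟨q, hq.eqOn hconn hp, fun e _ => hq₁ e⟩, fun i hi hb => ?_,
    fun e he => (hp.1 e he).le, le_rfl⟩
  have hb : N.b i = 0 := by simpa using hb
  have hin : ∃ e ∈ N.optSet, N.head e = i := by
    obtain ⟨e, he, rfl | rfl⟩ := hi
    · exact exists_head_eq_of_mem_optSet he hb
    · exact ⟨e, he, rfl⟩
  have hout : ∃ e ∈ N.optSet, N.tail e = i := by
    obtain ⟨e, he, rfl | rfl⟩ := hi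
    · exact ⟨e, he, rfl⟩
    · exact exists_tail_eq_of_mem_optSet he hb
  obtain ⟨e, he, hei⟩ := hin
  obtain ⟨f, hf, hfi⟩ := hout
  refine ⟨1, le_rfl, ⟨⟨e, ⟨he, hei⟩, hp.1 e he⟩, ?_⟩, ⟨⟨f, ⟨hf, hfi⟩, hp.1 f hf⟩, ?_⟩⟩
  · rintro _ ⟨g, ⟨hg, -⟩, rfl⟩
    exact (hp.1 g hg).le
  · rintro _ ⟨g, ⟨hg, -⟩, rfl⟩
    exact (hp.1 g hg).le

lemma ConstructionInvariant.step {H H' : Set E} {p p' : V → ℝ} {s : ℝ}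
    (h : N.ConstructionInvariant H p s) (hext : N.ElemExt (H, p) (H', p')) :
    ∃ s', 0 ≤ s' ∧ N.ConstructionInvariant H' p' s' := by
  obtain ⟨π, a, c, ht, hpos, hmax, rfl, hpp, hπ⟩ := hext
  dsimp only at *
  obtain ⟨q, hq, hqs, hqπ⟩ := ht.exists_extension hpos.le hmax
  obtain ⟨q₀, hq₀, hq₀s⟩ := h.exists_extension
  have hss : N.slope p π a c ≤ s := ht.slope_le hq₀ hq₀s
  set s' := N.slope p π a c with hs'
  have hfield : ∀ e ∈ H, N.field p' e = N.field p e := fun e he => field_congr hpp he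
  refine ⟨s', hpos.le, h.optSet_subset.trans Set.subset_union_left,
    h.isOptPotential.congr fun i hi => hpp i (verts_mono h.optSet_subset hi),
    ⟨q, ht.eqOn_union (fun i hi => (hq hi).trans (hpp i hi).symm)
      fun e he => (hqπ e he).trans (hπ e he).symm,
      fun e he => hqs e fun heH => he (Or.inl heH)⟩, fun i hi hb => ?_, ?_, hss.trans h.le_one⟩
  · by_cases hiH : i ∈ N.verts H
    · obtain ⟨r, hsr, ⟨⟨e, ⟨he, hei⟩, her⟩, h₁⟩, ⟨⟨f, ⟨hf, hfi⟩, hfr⟩, h₂⟩⟩ := h.harmonic i hiH hb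
      refine ⟨r, hss.trans hsr, ⟨⟨e, ⟨Or.inl he, hei⟩, by rw [hfield e he, her]⟩, ?_⟩,
        ⟨⟨f, ⟨Or.inl hf, hfi⟩, by rw [hfield f hf, hfr]⟩, ?_⟩⟩
      · rintro _ ⟨g, ⟨hg | hg, hgi⟩, rfl⟩
        · exact hfield g hg ▸ h₁ ⟨g, ⟨hg, hgi⟩, rfl⟩
        · exact (hπ g hg).trans_le (hss.trans hsr)
      · rintro _ ⟨g, ⟨hg | hg, hgi⟩, rfl⟩
        · exact hfield g hg ▸ h₂ ⟨g, ⟨hg, hgi⟩, rfl⟩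
        · exact (hπ g hg).trans_le (hss.trans hsr)
    · obtain ⟨e, he, hei⟩ := (ht.mem_verts_union hi).resolve_left hiH
      obtain ⟨f, hf, hfi⟩ := ht.walk.exists_tail_eq he (by
        rintro hc
        exact hiH (hei ▸ hc ▸ ht.end_mem))
      have hle : ∀ g ∈ H ∪ {e | e ∈ π}, N.head g = i ∨ N.tail g = i → N.field p' g ≤ s' := by
        rintro g (hg | hg) hgi
        · exact absurd ⟨g, hg, hgi.symm⟩ hiH
        · exact (hπ g hg).le
      refine ⟨s', le_rfl, ⟨⟨e, ⟨Or.inr he, hei⟩, hπ e he⟩, ?_⟩,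
        ⟨⟨f, ⟨Or.inr hf, hfi.trans hei⟩, hπ f hf⟩, ?_⟩⟩
      · rintro _ ⟨g, ⟨hg, hgi⟩, rfl⟩
        exact hle g hg (Or.inl hgi)
      · rintro _ ⟨g, ⟨hg, hgi⟩, rfl⟩
        exact hle g hg (Or.inr hgi)
  · rintro e (he | he)
    · exact hfield e he ▸ h.field_le_one e he
    · exact (hπ e he).trans_le (hss.trans h.le_one)

lemma ConstructionInvariant.of_reflTransGen (hconn : N.ConnectedSub N.optSet) {p₀ : V → ℝ}
    (hp₀ : N.IsOptPotential p₀) {X : Set E × (V → ℝ)}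
    (h : Relation.ReflTransGen N.ElemExt (N.optSet, p₀) X) :
    ∃ s, 0 ≤ s ∧ N.ConstructionInvariant X.1 X.2 s := by
  induction h with
  | refl => exact ⟨1, zero_le_one, constructionInvariant_optSet hconn hp₀⟩
  | tail _ hXY ih =>
    obtain ⟨s, -, hs⟩ := ih
    exact hs.step hXY

/-- The construction terminates, since every trajectory contains a new arc. -/
lemma exists_isConstructed (hconn : N.ConnectedSub N.optSet) : ∃ H p, N.IsConstructed H p := by
  have key : ∀ n : ℕ, ∀ X : Set E × (V → ℝ), X.1ᶜ.ncard ≤ n →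
      ∃ Y : Set E × (V → ℝ), Relation.ReflTransGen N.ElemExt X Y ∧
        ∀ π a c, N.IsTrajectory Y.1 π a c → N.slope Y.2 π a c ≤ 0 := by
    intro n
    induction n with
    | zero =>
      intro X hn
      refine ⟨X, .refl, fun π a c ht => ?_⟩
      obtain ⟨e, -, he⟩ := ht.new
      have : X.1ᶜ = ∅ := (Set.ncard_eq_zero (Set.toFinite _)).1 (by omega)
      exact (Set.notMem_empty e (this ▸ he)).elim
    | succ n ih =>
      intro X hn
      by_cases hX : ∀ π a c, N.IsTrajectory X.1 π a c → N.slope X.2 π a c ≤ 0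
      · exact ⟨X, .refl, hX⟩
      push Not at hX
      obtain ⟨π₀, a₀, c₀, ht₀, hpos₀⟩ := hX
      obtain ⟨π, a, c, ht, hmax⟩ := exists_isTrajectory_max_slope (p := X.2) ht₀
      have hpos := hpos₀.trans_le (hmax _ _ _ ht₀)
      obtain ⟨q, hq, -, hqπ⟩ := ht.exists_extension hpos.le hmax
      have hstep : N.ElemExt X (X.1 ∪ {e | e ∈ π}, q) :=
        ⟨π, a, c, ht, hpos, hmax, rfl, hq, hqπ⟩
      obtain ⟨Y, hY, hYs⟩ := ih (X.1 ∪ {e | e ∈ π}, q) (by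
        have : (X.1 ∪ {e | e ∈ π})ᶜ.ncard < X.1ᶜ.ncard := by
          obtain ⟨e, he, heX⟩ := ht.new
          refine Set.ncard_lt_ncard ⟨Set.compl_subset_compl.2 Set.subset_union_left, ?_⟩
            (Set.toFinite _)
          intro hsub
          exact hsub heX (Or.inr he)
        exact Nat.lt_succ_iff.1 (this.trans_le hn))
      exact ⟨Y, hY.head hstep, hYs⟩
  obtain ⟨p₀, hp₀, -⟩ := exists_isOptPotential_field_le_one hconn
  obtain ⟨⟨H, p⟩, h₁, h₂⟩ := key _ (N.optSet, p₀) le_rfl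
  exact ⟨H, p, ⟨p₀, hp₀, h₁⟩, h₂⟩

lemma support_subset_verts (hne : N.optSet.Nonempty) {H : Set E} (h : N.optSet ⊆ H) :
    Function.support N.b ⊆ N.verts H := fun i hi => by
  by_contra hiH
  exact hi (b_eq_zero_of_notMem_verts hne fun hio => hiH (verts_mono h hio))

lemma optSet_nonempty (hconn : N.ConnectedSub N.optSet) : N.optSet.Nonempty := by
  obtain ⟨i, e, he, -⟩ := hconn.nonempty_verts
  exact ⟨e, he⟩

lemma subset_of_reflTransGen {p₀ : V → ℝ} {X : Set E × (V → ℝ)}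
    (h : Relation.ReflTransGen N.ElemExt (N.optSet, p₀) X) : N.optSet ⊆ X.1 := by
  induction h with
  | refl => exact subset_rfl
  | tail _ hXY ih =>
    obtain ⟨π, a, c, -, -, -, hY, -⟩ := hXY
    rw [hY]
    exact ih.trans Set.subset_union_left

/-- Every stage `X` of the construction is contained in every `∞`-harmonic extension `p'` of the
potential of the optimal set, if `p'` has nonpositive field on the arcs of `X` outside its
domain `H'`. -/
lemma subset_and_eqOn_of_reflTransGen (hconn : N.ConnectedSub N.optSet) {p₀ p' : V → ℝ}
    {H' : Set E} (hp₀ : N.IsOptPotential p₀) (hH' : N.optSet ⊆ H') (hp'₀ : N.IsOptPotential p')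
    (hp' : N.IsInfHarmonic H' (Function.support N.b) p') {X : Set E × (V → ℝ)}
    (h : Relation.ReflTransGen N.ElemExt (N.optSet, p₀) X)
    (hX : ∀ e ∈ X.1, e ∈ H' ∨ N.field p' e ≤ 0) :
    X.1 ⊆ H' ∧ Set.EqOn p' X.2 (N.verts X.1) := by
  induction h with
  | refl => exact ⟨hH', hp'₀.eqOn hconn hp₀⟩
  | @tail X Y hX₀ hXY ih =>
    obtain ⟨π, a, c, ht, hpos, hmax, hY₁, hY₂, hY₃⟩ := hXY
    rw [hY₁] at hX ⊢
    obtain ⟨ih₁, ih₂⟩ := ih fun e he => hX e (Or.inl he)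
    have hS := support_subset_verts (optSet_nonempty hconn) (subset_of_reflTransGen hX₀)
    have hπ := hp'.mem_and_field_eq hS ih₂ ht hpos hmax fun e he => hX e (Or.inr he)
    refine ⟨Set.union_subset ih₁ fun e he => (hπ e he).1, ht.eqOn_union (fun i hi => ?_) ?_⟩
    · rw [ih₂ hi, hY₂ i hi]
    · exact fun e he => (hπ e he).2.trans (hY₃ e he).symm

lemma IsConstructed.optSet_subset {H : Set E} {p : V → ℝ} (h : N.IsConstructed H p) :
    N.optSet ⊆ H := by
  obtain ⟨⟨p₀, -, h₁⟩, -⟩ := h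
  exact subset_of_reflTransGen h₁

lemma IsConstructed.isOptPotential (hconn : N.ConnectedSub N.optSet) {H : Set E} {p : V → ℝ}
    (h : N.IsConstructed H p) : N.IsOptPotential p := by
  obtain ⟨⟨p₀, hp₀, h₁⟩, -⟩ := h
  obtain ⟨s, -, hs⟩ := ConstructionInvariant.of_reflTransGen hconn hp₀ h₁
  exact hs.isOptPotential

lemma IsConstructed.isInfHarmonic (hconn : N.ConnectedSub N.optSet) {H : Set E} {p : V → ℝ}
    (h : N.IsConstructed H p) : N.IsInfHarmonic H (Function.support N.b) p := by
  obtain ⟨⟨p₀, hp₀, h₁⟩, -⟩ := h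
  obtain ⟨s, hs₀, hs⟩ := ConstructionInvariant.of_reflTransGen hconn hp₀ h₁
  intro i hi hib
  obtain ⟨r, hr, h₂⟩ := hs.harmonic i hi hib
  exact ⟨r, hs₀.trans hr, h₂⟩

lemma IsConstructed.field_le_one (hconn : N.ConnectedSub N.optSet) {H : Set E} {p : V → ℝ}
    (h : N.IsConstructed H p) {e : E} (he : e ∈ H) : N.field p e ≤ 1 := by
  obtain ⟨⟨p₀, hp₀, h₁⟩, -⟩ := h
  obtain ⟨s, hs₀, hs⟩ := ConstructionInvariant.of_reflTransGen hconn hp₀ h₁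
  exact hs.field_le_one e he

lemma IsConstructed.exists_extension {H : Set E} {p : V → ℝ} (h : N.IsConstructed H p) :
    ∃ q : V → ℝ, Set.EqOn q p (N.verts H) ∧ ∀ e ∉ H, N.field q e ≤ 0 :=
  exists_extension_of_slope_le le_rfl h.2

/-- Two outcomes of the construction are compared by extending the potential of one of them with
nonpositive field outside its domain. -/
lemma IsConstructed.subset_and_eqOn (hconn : N.ConnectedSub N.optSet) {H H' : Set E}
    {p p' : V → ℝ} (h : N.IsConstructed H p) (h' : N.IsConstructed H' p') :
    H ⊆ H' ∧ Set.EqOn p' p (N.verts H) := by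
  obtain ⟨⟨p₀, hp₀, h₁⟩, -⟩ := h
  obtain ⟨q, hq, hq₀⟩ := h'.exists_extension
  obtain ⟨hsub, heq⟩ := subset_and_eqOn_of_reflTransGen hconn hp₀ h'.optSet_subset
    ((h'.isOptPotential hconn).congr (hq.mono (verts_mono h'.optSet_subset)))
    ((h'.isInfHarmonic hconn).congr hq) h₁
    (fun e _ => or_iff_not_imp_left.2 fun he => hq₀ e he)
  exact ⟨hsub, fun i hi => (hq (verts_mono hsub hi)).symm.trans (heq hi)⟩

/-- Induction along the construction: a property of vertices that holds on `V(Ĥ)` holds on `V(H)`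
if it extends along constant-slope paths of arcs of maximum field among the arcs outside the part
reached so far. -/
lemma IsConstructed.induction (hconn : N.ConnectedSub N.optSet) {Hs : Set E} {ps q : V → ℝ}
    (h : N.IsConstructed Hs ps) (hq : Set.EqOn q ps (N.verts Hs)) (hq₀ : ∀ e ∉ Hs, N.field q e ≤ 0)
    {G : V → Prop} (hbase : ∀ i ∈ N.verts N.optSet, G i)
    (hstep : ∀ (H : Set E) (s : ℝ) (π : List E) (a c : V), N.optSet ⊆ H → 0 < s →
      (∀ i ∈ N.verts H, G i) → (∀ e ∉ H, N.field q e ≤ s) → N.IsDirWalk π a c →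
      a ∈ N.verts H → c ∈ N.verts H → (∀ e ∈ π, e ∉ H) → (∀ e ∈ π, e ∈ Hs ∧ N.field q e = s) →
      ∀ e ∈ π, G (N.head e)) : ∀ i ∈ N.verts Hs, G i := by
  have hopt := (h.isOptPotential hconn).congr (hq.mono (verts_mono h.optSet_subset))
  have hharm := (h.isInfHarmonic hconn).congr hq
  obtain ⟨⟨p₀, hp₀, h₁⟩, -⟩ := h
  have key : ∀ X, Relation.ReflTransGen N.ElemExt (N.optSet, p₀) X → ∀ i ∈ N.verts X.1, G i := by
    intro X hX
    induction hX with
    | refl => exact hbase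
    | @tail X Y hX₀ hXY ih =>
      obtain ⟨π, a, c, ht, hpos, hmax, hY₁, hY₂, hY₃⟩ := hXY
      have hor : ∀ e, e ∈ Hs ∨ N.field q e ≤ 0 := fun e =>
        or_iff_not_imp_left.2 fun he => hq₀ e he
      have hsub := subset_of_reflTransGen hX₀
      have hS := support_subset_verts (optSet_nonempty hconn) hsub
      obtain ⟨-, heq⟩ := subset_and_eqOn_of_reflTransGen hconn hp₀
        (subset_of_reflTransGen h₁) hopt hharm hX₀ (fun e _ => hor e)
      rw [hY₁]
      intro i hi
      rcases ht.mem_verts_union hi with hi | ⟨e, he, rfl⟩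
      · exact ih i hi
      · refine hstep X.1 _ π a c hsub hpos ih (fun e he => ?_) ht.walk ht.start_mem ht.end_mem
          (fun e he => ht.notMem he) (hharm.mem_and_field_eq hS heq ht hpos hmax fun e _ => hor e) e he
        rcases hor e with heHs | hle
        · exact hharm.field_le_slope hS heq ht hpos hmax heHs he
        · exact hle.trans hpos.le
  exact key _ h₁

end TransshipmentProblem

/-! ### Real estimates -/

lemma eq_of_hasDerivWithinAt_zero {f : ℝ → ℝ}
    (h : ∀ t, 0 ≤ t → HasDerivWithinAt f 0 (Set.Ici 0) t) {t : ℝ} (ht : 0 ≤ t) : f t = f 0 :=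
  constant_of_has_deriv_right_zero (a := 0) (b := t)
    (fun x hx => (h x hx.1).continuousWithinAt.mono Set.Icc_subset_Ici_self)
    (fun x hx => (h x hx.1).mono (Set.Ici_subset_Ici.2 hx.1)) t ⟨ht, le_rfl⟩

lemma exists_nonneg_forall_le {ι : Type*} [Finite ι] (a : ι → ℝ) : ∃ M, 0 ≤ M ∧ ∀ i, a i ≤ M := by
  have := Fintype.ofFinite ι
  exact ⟨∑ i, |a i|, Finset.sum_nonneg fun _ _ => abs_nonneg _, fun i => (le_abs_self _).trans
    (Finset.single_le_sum (f := fun i => |a i|) (fun _ _ => abs_nonneg _) (Finset.mem_univ i))⟩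

/-- Coercivity of the entropy term, uniformly for bounded `φ`: in both directions, if `φ` stays away
from zero. -/
lemma exists_entropy_bound {σ₀ Φ : ℝ} (hσ : 0 < σ₀) :
    ∃ K, 0 ≤ K ∧ ∀ φ y, 0 ≤ φ → φ ≤ Φ → y - K ≤ (σ₀ * Real.exp y - φ) * y ∧
      -φ * y - K ≤ (σ₀ * Real.exp y - φ) * y := by
  have h₀ : ∀ y, -σ₀ ≤ σ₀ * (Real.exp y * y) := by
    intro y
    have h₁ : -1 ≤ Real.exp y * y := by
      have h₂ := Real.add_one_le_exp (-y)
      have h₃ : Real.exp y * Real.exp (-y) = 1 := by rw [← Real.exp_add]; simp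
      have h₄ := mul_le_mul_of_nonneg_left h₂ (Real.exp_pos y).le
      nlinarith [Real.exp_pos y]
    nlinarith
  refine ⟨σ₀ + (Φ + 1) ^ 2 / (4 * σ₀), by positivity, fun φ y hφ hΦ => ⟨?_, ?_⟩⟩
  · have hsq : 0 ≤ (Φ + 1) ^ 2 / (4 * σ₀) := by positivity
    rcases le_total 0 y with hy | hy
    · have h₁ : σ₀ * y ^ 2 ≤ σ₀ * (Real.exp y * y) := by
        refine mul_le_mul_of_nonneg_left ?_ hσ.le
        nlinarith [Real.add_one_le_exp y]
      have h₂ : (Φ + 1) * y ≤ σ₀ * y ^ 2 + (Φ + 1) ^ 2 / (4 * σ₀) := by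
        have h₃ : σ₀ * y ^ 2 + (Φ + 1) ^ 2 / (4 * σ₀) - (Φ + 1) * y =
            (2 * σ₀ * y - (Φ + 1)) ^ 2 / (4 * σ₀) := by
          field_simp
          ring
        have h₄ : 0 ≤ (2 * σ₀ * y - (Φ + 1)) ^ 2 / (4 * σ₀) := by positivity
        linarith
      nlinarith [mul_le_mul_of_nonneg_right hΦ hy]
    · nlinarith [h₀ y, mul_nonpos_of_nonneg_of_nonpos hφ hy]
  · have hsq : 0 ≤ (Φ + 1) ^ 2 / (4 * σ₀) := by positivity
    nlinarith [h₀ y]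

namespace TransshipmentProblem

variable {V E : Type*} [Fintype V] [Fintype E] [DecidableEq V] {N : TransshipmentProblem V E}

/-! ### Runs of the Physarum solver as exponential penalty trajectories -/

/-- The integrated form of a run, with the potentials integrated over time: the conductivities are
`σ_e(0) exp (Ψ(P)_e - t)`, and their boundary `b(t)` is exponentially close to `b`. Equivalently,
`P(t)` minimises `∑ ℓ_e σ_e(0) exp (Ψ(P)_e - t) - ∑ b_i(t) P_i`, in which exponential penalties
replace the constraints `Ψ(P)_e ≤ t`. -/
structure IsPenaltyPath (N : TransshipmentProblem V E) (σ : ℝ → E → ℝ) (P : ℝ → V → ℝ) : Prop where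
  pos : ∀ e, 0 < σ 0 e
  eq_exp : ∀ t, 0 ≤ t → ∀ e, σ t e = σ 0 e * Real.exp (N.field (P t) e - t)
  boundary_eq : ∀ t, 0 ≤ t → ∀ i, N.boundary.mulVec (σ t) i =
    N.b i + Real.exp (-t) * (N.boundary.mulVec (σ 0) i - N.b i)

lemma laplacian_mulVec [DecidableEq E] (σ : E → ℝ) (p : V → ℝ) :
    (N.laplacian σ).mulVec p = N.boundary.mulVec (N.current σ p) := by
  rw [laplacian, ← Matrix.mulVec_mulVec, ← Matrix.mulVec_mulVec]
  congr 1
  funext e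
  have h : N.boundary.transpose.mulVec p e = p (N.tail e) - p (N.head e) := by
    have := N.sum_boundary_mulVec_mul (Pi.single e 1) p
    simpa [Matrix.mulVec, dotProduct, Pi.single_apply] using this
  rw [Matrix.mulVec_diagonal, h, current, field]
  ring

lemma IsPhysarumRun.exists_isPenaltyPath [DecidableEq E] {σ : ℝ → E → ℝ} {p : ℝ → V → ℝ}
    (h : N.IsPhysarumRun σ p) : ∃ P, N.IsPenaltyPath σ P := by
  obtain ⟨r⟩ := N.connected.nonempty
  -- The drop of `P` along an arc is the integral of `p_i - p_j = ℓ (log σ + t)'`.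
  have hlog : ∀ e, ∀ t, 0 ≤ t → HasDerivWithinAt
      (fun t => N.len e * (Real.log (σ t e) - Real.log (σ 0 e) + t))
      (p t (N.tail e) - p t (N.head e)) (Set.Ici 0) t := by
    intro e t ht
    have hpos := h.pos t ht e
    have h₁ := ((((h.ode t ht e).log hpos.ne').sub_const (Real.log (σ 0 e))).add
      (hasDerivWithinAt_id t _)).const_mul (N.len e)
    refine h₁.congr_deriv ?_
    rw [← field_mul_len, current]
    field_simp
    ring
  have hP : ∀ i, ∃ f : ℝ → ℝ, f 0 = 0 ∧
      ∀ t, 0 ≤ t → HasDerivWithinAt f (p t i - p t r) (Set.Ici 0) t := by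
    intro i
    refine N.induction_of_connected (G := fun i => ∃ f : ℝ → ℝ, f 0 = 0 ∧
      ∀ t, 0 ≤ t → HasDerivWithinAt f (p t i - p t r) (Set.Ici 0) t) (fun e => ⟨?_, ?_⟩)
      (i := r) ⟨fun _ => 0, rfl, fun t _ => by simpa using hasDerivWithinAt_const t _ (0 : ℝ)⟩ i
    · rintro ⟨f, hf₀, hf⟩
      refine ⟨_, ?_, fun t ht => ((hf t ht).sub (hlog e t ht)).congr_deriv (by ring)⟩
      simp [hf₀]
    · rintro ⟨f, hf₀, hf⟩
      refine ⟨_, ?_, fun t ht => ((hf t ht).add (hlog e t ht)).congr_deriv (by ring)⟩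
      simp [hf₀]
  choose f hf₀ hf using hP
  refine ⟨fun t i => f i t, h.pos 0 le_rfl, fun t ht e => ?_, fun t ht i => ?_⟩
  · have h₁ := eq_of_hasDerivWithinAt_zero (fun t ht =>
      (((hf (N.tail e) t ht).sub (hf (N.head e) t ht)).sub (hlog e t ht)).congr_deriv (by ring)) ht
    simp only [Pi.sub_apply, hf₀, sub_self, add_zero, mul_zero] at h₁
    have h₂ : N.field (fun i => f i t) e - t = Real.log (σ t e) - Real.log (σ 0 e) := by
      have := (N.field_eq_iff (fun i => f i t) e (Real.log (σ t e) - Real.log (σ 0 e) + t)).2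
        (by rw [mul_comm]; linarith)
      rw [this]
      ring
    rw [h₂, Real.exp_sub, Real.exp_log (h.pos t ht e), Real.exp_log (h.pos 0 le_rfl e),
      mul_div_cancel₀ _ (h.pos 0 le_rfl e).ne']
  · have hd : ∀ t, 0 ≤ t → HasDerivWithinAt (fun t => N.boundary.mulVec (σ t) i)
        (N.b i - N.boundary.mulVec (σ t) i) (Set.Ici 0) t := by
      intro t ht
      have h₁ : HasDerivWithinAt (fun t => ∑ e, N.boundary i e * σ t e)
          (∑ e, N.boundary i e * (N.current (σ t) (p t) e - σ t e)) (Set.Ici 0) t :=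
        HasDerivWithinAt.fun_sum fun e _ => (h.ode t ht e).const_mul _
      refine h₁.congr_deriv ?_
      rw [← h.kirchhoff t ht, laplacian_mulVec]
      simp only [mul_sub, Finset.sum_sub_distrib]
      rfl
    have h₁ := eq_of_hasDerivWithinAt_zero (fun t ht =>
      (((Real.hasDerivAt_exp t).hasDerivWithinAt (s := Set.Ici 0)).mul
        ((hd t ht).sub_const (N.b i))).congr_deriv (by ring)) ht
    simp only [Pi.mul_apply, Real.exp_zero, one_mul] at h₁
    rw [← h₁, ← mul_assoc, ← Real.exp_add]
    simp

/-! ### Bounded distance of the integrated potentials from the limit potential -/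

/-- The conductivities of the arcs of `Ĥ` are bounded, above and away from zero. With `φ` an optimal
flow, the flow `φ + exp (-t) (σ(0) - φ)` has the same boundary as `σ(t)`, and the pairing of the
difference with `P - t q` vanishes, which bounds a relative entropy. -/
lemma IsPenaltyPath.abs_drop_le_of_mem_optSet {σ : ℝ → E → ℝ} {P : ℝ → V → ℝ}
    (h : N.IsPenaltyPath σ P) {q : V → ℝ} (hq : ∀ e, N.field q e ≤ 1)
    (hq₁ : ∀ e ∈ N.optSet, N.field q e = 1) {e : E} (he : e ∈ N.optSet) :
    ∃ C, ∀ t, 0 ≤ t →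
      |(P t (N.tail e) - t * q (N.tail e)) - (P t (N.head e) - t * q (N.head e))| ≤ C := by
  obtain ⟨φ, hφ, hpos⟩ := exists_optFlow_pos ⟨e, he⟩
  have hK := fun f => exists_entropy_bound (Φ := φ f + σ 0 f) (h.pos f)
  choose K hK₀ hK using hK
  set C : ℝ := ∑ f, N.len f * (1 - N.field q f) * σ 0 f + ∑ f, N.len f * K f with hC
  set m : ℝ := min (φ e) (σ 0 e) with hm
  have hmpos : 0 < m := lt_min (hpos e he) (h.pos e)
  have hkey : ∀ t, 0 ≤ t → ∃ ψ, 0 ≤ ψ ∧ ψ ≤ φ e + σ 0 e ∧ m ≤ ψ ∧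
      N.len e * ((σ 0 e * Real.exp (N.field (P t) e - t) - ψ) * (N.field (P t) e - t)) ≤
        C - N.len e * K e := by
    intro t ht
    have hexp₀ := Real.exp_pos (-t)
    have hexp₁ : Real.exp (-t) ≤ 1 := Real.exp_le_one_iff.2 (by linarith)
    set ψ : E → ℝ := fun f => φ f + Real.exp (-t) * (σ 0 f - φ f) with hψ
    have hφ₀ := hφ.1.2
    have hσ₀ := fun f => (h.pos f).le
    have hψ₀ : ∀ f, 0 ≤ ψ f := fun f => by
      have := mul_nonneg hexp₀.le (hσ₀ f)
      have := mul_nonneg (sub_nonneg.2 hexp₁) (hφ₀ f)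
      simp only [hψ]
      linarith
    have hψ₁ : ∀ f, ψ f ≤ φ f + σ 0 f := fun f => by
      have := mul_le_mul_of_nonneg_right hexp₁ (hσ₀ f)
      have := mul_nonneg hexp₀.le (hφ₀ f)
      simp only [hψ]
      linarith
    refine ⟨ψ e, hψ₀ e, hψ₁ e, ?_, ?_⟩
    · have h₁ := mul_le_mul_of_nonneg_left (min_le_right (φ e) (σ 0 e)) hexp₀.le
      have h₂ := mul_le_mul_of_nonneg_left (min_le_left (φ e) (σ 0 e)) (sub_nonneg.2 hexp₁)
      simp only [hψ, hm]
      linarith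
    set T : E → ℝ := fun f =>
      N.len f * ((σ 0 f * Real.exp (N.field (P t) f - t) - ψ f) * (N.field (P t) f - t)) with hT
    -- Both `σ t` and `ψ` have the boundary `b + exp (-t) (B σ(0) - b)`.
    have hzero : ∑ f, (σ t f - ψ f) * (N.field (P t) f * N.len f - t * (N.field q f * N.len f)) =
        0 := by
      have hB : N.boundary.mulVec (fun f => σ t f - ψ f) = 0 := by
        have h₁ : N.boundary.mulVec ψ = N.boundary.mulVec (σ t) := by
          have h₂ : ψ = φ + Real.exp (-t) • (σ 0 - φ) := by
            funext f
            simp [hψ]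
          rw [h₂, Matrix.mulVec_add, Matrix.mulVec_smul, Matrix.mulVec_sub, hφ.1.1]
          funext i
          simp [h.boundary_eq t ht i]
        have h₃ : (fun f => σ t f - ψ f) = σ t - ψ := rfl
        rw [h₃, Matrix.mulVec_sub, h₁, sub_self]
      have h₁ := boundary_mulVec_eq_iff.1 hB fun i => P t i - t * q i
      simp only [Pi.zero_apply, zero_mul, Finset.sum_const_zero] at h₁
      rw [← h₁]
      refine Finset.sum_congr rfl fun f _ => ?_
      rw [field_mul_len, field_mul_len]
      ring
    have hsum : ∑ f, T f ≤ ∑ f, N.len f * (1 - N.field q f) * σ 0 f := by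
      have h₁ : ∑ f, T f = ∑ f, T f -
          ∑ f, (σ t f - ψ f) * (N.field (P t) f * N.len f - t * (N.field q f * N.len f)) := by
        rw [hzero, sub_zero]
      rw [h₁, ← Finset.sum_sub_distrib]
      refine Finset.sum_le_sum fun f _ => ?_
      have hκ : 0 ≤ N.len f * (1 - N.field q f) :=
        mul_nonneg (N.len_pos f).le (sub_nonneg.2 (hq f))
      have h₂ : T f - (σ t f - ψ f) * (N.field (P t) f * N.len f - t * (N.field q f * N.len f)) =
          t * (N.len f * (1 - N.field q f)) * (ψ f - σ t f) := by
        simp only [hT]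
        rw [h.eq_exp t ht f]
        ring
      have h₃ : N.len f * (1 - N.field q f) * ψ f =
          N.len f * (1 - N.field q f) * (Real.exp (-t) * σ 0 f) := by
        by_cases hf : f ∈ N.optSet
        · simp [hq₁ f hf]
        · simp [hψ, hφ.eq_zero hf]
      have h₄ : t * Real.exp (-t) ≤ 1 := by
        have h₅ := Real.add_one_le_exp t
        have h₆ : Real.exp t * Real.exp (-t) = 1 := by rw [← Real.exp_add]; simp
        nlinarith
      have h₇ : 0 ≤ t * (N.len f * (1 - N.field q f)) * σ t f := by
        rw [h.eq_exp t ht f]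
        have := h.pos f
        positivity
      have h₈ := mul_le_mul_of_nonneg_right h₄ (mul_nonneg hκ (hσ₀ f))
      rw [h₂]
      calc t * (N.len f * (1 - N.field q f)) * (ψ f - σ t f)
          ≤ t * (N.len f * (1 - N.field q f) * ψ f) := by linarith
        _ = t * Real.exp (-t) * (N.len f * (1 - N.field q f) * σ 0 f) := by rw [h₃]; ring
        _ ≤ N.len f * (1 - N.field q f) * σ 0 f := by linarith
    have hTK : ∀ f, -(N.len f * K f) ≤ T f := fun f => by
      have hmul := mul_le_mul_of_nonneg_left (hK f (ψ f) (N.field (P t) f - t) (hψ₀ f) (hψ₁ f)).1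
        (N.len_pos f).le
      have hmul' := mul_le_mul_of_nonneg_left (hK f (ψ f) (N.field (P t) f - t) (hψ₀ f) (hψ₁ f)).2
        (N.len_pos f).le
      have hlen := N.len_pos f
      simp only [hT]
      rcases le_total 0 (N.field (P t) f - t) with hy | hy
      · have := mul_nonneg hlen.le hy
        linarith
      · have := mul_nonneg hlen.le (mul_nonneg (hψ₀ f) (neg_nonneg.2 hy))
        linarith
    have h₁ : T e + N.len e * K e ≤ ∑ f, (T f + N.len f * K f) :=
      Finset.single_le_sum (f := fun f => T f + N.len f * K f)
        (fun f _ => by linarith [hTK f]) (Finset.mem_univ e)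
    rw [Finset.sum_add_distrib] at h₁
    change T e ≤ C - N.len e * K e
    linarith
  have hlen := N.len_pos e
  have hCK : 0 ≤ C := by
    refine add_nonneg (Finset.sum_nonneg fun f _ => ?_) (Finset.sum_nonneg fun f _ => ?_)
    · exact mul_nonneg (mul_nonneg (N.len_pos f).le (sub_nonneg.2 (hq f))) (h.pos f).le
    · exact mul_nonneg (N.len_pos f).le (hK₀ f)
  refine ⟨max C (C / m), fun t ht => ?_⟩
  obtain ⟨ψ, h₀, h₁, h₂, h₃⟩ := hkey t ht
  set y := N.field (P t) e - t with hy
  have hdrop : (P t (N.tail e) - t * q (N.tail e)) - (P t (N.head e) - t * q (N.head e)) =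
      N.len e * y := by
    have h₄ := (N.field_eq_iff q e 1).1 (hq₁ e he)
    have h₅ := N.field_mul_len (P t) e
    rw [hy]
    linear_combination -h₅ - t * h₄
  obtain ⟨h₆, h₇⟩ := hK e ψ y h₀ h₁
  have h₈ := mul_le_mul_of_nonneg_left h₆ hlen.le
  have h₉ := mul_le_mul_of_nonneg_left h₇ hlen.le
  rw [hdrop, abs_le]
  constructor
  · rw [neg_le]
    refine le_trans ?_ (le_max_right _ _)
    rw [le_div_iff₀ hmpos]
    rcases le_total 0 y with h' | h'
    · have := mul_nonneg (mul_nonneg hlen.le h') hmpos.le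
      linarith
    · have := mul_le_mul_of_nonneg_left h₂ (mul_nonneg hlen.le (neg_nonneg.2 h'))
      linarith
  · exact le_trans (by linarith) (le_max_left _ _)

/-- Suppose that `P - t q` is bounded on `V(H)`, up to additive constants, and that `q` has field at
most `s` outside `H`. Then `Ψ(P)` is at most `s t + O(1)` outside `H`: since the boundary of `σ` is
nearly zero outside `V(H)`, arcs of larger conductivity could be followed until they return to
`V(H)` at both ends. -/
lemma IsPenaltyPath.field_le {σ : ℝ → E → ℝ} {P : ℝ → V → ℝ}
    (h : N.IsPenaltyPath σ P) {q : V → ℝ} {H : Set E} {s : ℝ} {r : V} (hs : 0 ≤ s)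
    (hb : Function.support N.b ⊆ N.verts H) (hq : ∀ e ∉ H, N.field q e ≤ s)
    (hH : ∀ i ∈ N.verts H, ∃ C, ∀ t, 0 ≤ t → |(P t i - t * q i) - (P t r - t * q r)| ≤ C)
    {e : E} (he : e ∉ H) : ∃ C, 0 ≤ C ∧ ∀ t, 0 ≤ t → N.field (P t) e ≤ s * t + C := by
  choose! C₀ hC₀ using hH
  obtain ⟨C, hCnonneg, hC⟩ := exists_nonneg_forall_le C₀
  have hE : 0 < (Fintype.card E : ℝ) := by
    have : Nonempty E := ⟨e⟩
    exact_mod_cast Fintype.card_pos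
  -- `δ` bounds the loss per step, and above `θ` the boundary of `σ` is negligible.
  obtain ⟨δ, hδ₀, hδ⟩ := exists_nonneg_forall_le fun x : E × E =>
    2 * Fintype.card E * σ 0 x.2 / σ 0 x.1
  obtain ⟨θ, hθ₀, hθ⟩ := exists_nonneg_forall_le fun x : E × V =>
    2 * |N.boundary.mulVec (σ 0) x.2 - N.b x.2| / σ 0 x.1
  have hδ' : ∀ e f, 2 * Fintype.card E * σ 0 f ≤ Real.exp δ * σ 0 e := fun e f => by
    have h₁ := (div_le_iff₀ (h.pos e)).1 (hδ (e, f))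
    have h₂ := Real.add_one_le_exp δ
    nlinarith [h.pos e]
  have hθ' : ∀ e i, 2 * |N.boundary.mulVec (σ 0) i - N.b i| ≤ Real.exp θ * σ 0 e := fun e i => by
    have h₁ := (div_le_iff₀ (h.pos e)).1 (hθ (e, i))
    have h₂ := Real.add_one_le_exp θ
    nlinarith [h.pos e]
  have hσpos : ∀ t, 0 ≤ t → ∀ e, 0 < σ t e := fun t ht e => by
    rw [h.eq_exp t ht]
    exact mul_pos (h.pos e) (Real.exp_pos _)
  have hlarge : ∀ t, 0 ≤ t → ∀ e i, i ∉ N.verts H → s * t + θ < N.field (P t) e →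
      σ t e / 2 ≤ σ t e - |N.boundary.mulVec (σ t) i| := by
    intro t ht e i hi hlt
    have hbi : N.b i = 0 := by
      by_contra hne
      exact hi (hb hne)
    have h₁ : |N.boundary.mulVec (σ t) i| =
        Real.exp (-t) * |N.boundary.mulVec (σ 0) i - N.b i| := by
      rw [h.boundary_eq t ht i, hbi, zero_add, abs_mul, abs_of_pos (Real.exp_pos _)]
    have h₂ : Real.exp θ * Real.exp (-t) * σ 0 e ≤ σ t e := by
      rw [h.eq_exp t ht e, mul_comm (σ 0 e), ← Real.exp_add]
      refine mul_le_mul_of_nonneg_right (Real.exp_le_exp.2 ?_) (h.pos e).le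
      have := mul_nonneg hs ht
      linarith
    have h₃ := mul_le_mul_of_nonneg_left (hθ' e i) (Real.exp_pos (-t)).le
    rw [h₁]
    linarith
  have hloss : ∀ t, 0 ≤ t → ∀ e f, σ t e / 2 / Fintype.card E ≤ σ t f →
      N.field (P t) e - δ ≤ N.field (P t) f := by
    intro t ht e f hef
    rw [div_div, div_le_iff₀ (by positivity), h.eq_exp t ht e, h.eq_exp t ht f] at hef
    have h₁ := mul_le_mul_of_nonneg_left (hδ' e f) (Real.exp_pos (N.field (P t) f - t)).le
    have h₂ : Real.exp (N.field (P t) e - t) ≤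
        Real.exp (N.field (P t) f - t + δ) := by
      rw [Real.exp_add]
      refine le_of_mul_le_mul_right ?_ (h.pos e)
      linarith
    have h₃ := Real.exp_le_exp.1 h₂
    linarith
  refine ⟨θ + δ * Fintype.card V + 2 * C / N.len e, by
    have := N.len_pos e
    positivity, fun t ht => ?_⟩
  have hlen := N.len_pos e
  have hst := mul_nonneg hs ht
  by_contra! hlt
  have hx : s * t + θ + δ * Fintype.card V < N.field (P t) e := by
    have : 0 ≤ 2 * C / N.len e := by positivity
    linarith
  have hdec : ∀ e, s * t + θ < N.field (P t) e → P t (N.head e) < P t (N.tail e) := by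
    intro e hs'
    have h₁ := N.field_mul_len (P t) e
    have h₂ := mul_pos (show 0 < N.field (P t) e by linarith) (N.len_pos e)
    linarith
  have hu : ∀ e ∉ H, (N.field (P t) e - s * t) * N.len e ≤
      (P t (N.tail e) - t * q (N.tail e)) - (P t (N.head e) - t * q (N.head e)) := by
    intro e he
    have h₁ := N.field_mul_len (P t) e
    have h₂ := mul_le_mul_of_nonneg_left ((N.field_le_iff q e s).1 (hq e he)) ht
    linarith
  have hu' : ∀ e ∉ H, s * t + θ < N.field (P t) e →
      P t (N.head e) - t * q (N.head e) ≤ P t (N.tail e) - t * q (N.tail e) := by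
    intro e he hs'
    have h₁ := hu e he
    have h₂ := mul_nonneg (show 0 ≤ N.field (P t) e - s * t by linarith) (N.len_pos e).le
    linarith
  obtain ⟨c, hc, hcu⟩ := exists_mem_le_of_follow (tl := N.tail) (hd := N.head)
    (x := N.field (P t)) (f := P t) (u := fun i => P t i - t * q i) (W := N.verts H)
    (A := Set.univ) hδ₀ (fun e _ => hdec e)
    (fun e _ hW h' => hu' e (fun heH => hW (tail_mem_verts heH)) h')
    (fun e _ hW h' => by
      obtain ⟨f, hf, hσf⟩ := exists_out_arc (N := N) (e := e) (fun f => (hσpos t ht f).le)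
        (div_pos (half_pos (hσpos t ht e)) hE) (by
          rw [mul_div_cancel₀ _ hE.ne']
          have h₁ := hlarge t ht e _ hW h'
          have h₂ := neg_abs_le (N.boundary.mulVec (σ t) (N.head e))
          linarith)
      exact ⟨f, trivial, hf, hloss t ht e f hσf⟩) (Set.mem_univ e) hx
  obtain ⟨a, ha, hau⟩ := exists_mem_le_of_follow (tl := N.head) (hd := N.tail)
    (x := N.field (P t)) (f := fun i => - P t i) (u := fun i => -(P t i - t * q i))
    (W := N.verts H) (A := Set.univ) hδ₀ (fun e _ h' => neg_lt_neg (hdec e h'))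
    (fun e _ hW h' => neg_le_neg (hu' e (fun heH => hW (head_mem_verts heH)) h'))
    (fun e _ hW h' => by
      obtain ⟨f, hf, hσf⟩ := exists_in_arc (N := N) (e := e) (fun f => (hσpos t ht f).le)
        (div_pos (half_pos (hσpos t ht e)) hE) (by
          rw [mul_div_cancel₀ _ hE.ne']
          have h₁ := hlarge t ht e _ hW h'
          have h₂ := le_abs_self (N.boundary.mulVec (σ t) (N.tail e))
          linarith)
      exact ⟨f, trivial, hf, hloss t ht e f hσf⟩) (Set.mem_univ e) hx
  have h₁ := hu e he
  have h₂ := (abs_le.1 ((hC₀ c hc t ht).trans (hC c))).1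
  have h₃ := (abs_le.1 ((hC₀ a ha t ht).trans (hC a))).2
  have h₄ : 2 * C < (N.field (P t) e - s * t) * N.len e := by
    rw [← div_lt_iff₀ hlen]
    have : 0 ≤ δ * Fintype.card V := by positivity
    linarith

  linarith

/-- `P - t q` is bounded on `V(Hs)` up to additive constants. Along a path of constant field `s`, all
drops of `P - t q` are bounded above by `IsPenaltyPath.field_le`, and since the ends are under control
they are bounded below as well. -/
lemma IsPenaltyPath.bounded (hconn : N.ConnectedSub N.optSet) {σ : ℝ → E → ℝ}
    {P : ℝ → V → ℝ} (h : N.IsPenaltyPath σ P) {Hs : Set E} {ps q : V → ℝ}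
    (hc : N.IsConstructed Hs ps) (hqs : Set.EqOn q ps (N.verts Hs))
    (hq₀ : ∀ e ∉ Hs, N.field q e ≤ 0) {r : V} (hr : r ∈ N.verts N.optSet) :
    ∀ i ∈ N.verts Hs, ∃ C, ∀ t, 0 ≤ t → |(P t i - t * q i) - (P t r - t * q r)| ≤ C := by
  have hq : ∀ e, N.field q e ≤ 1 := fun e => by
    by_cases he : e ∈ Hs
    · rw [field_congr hqs he]
      exact hc.field_le_one hconn he
    · exact (hq₀ e he).trans zero_le_one
  have hq₁ : ∀ e ∈ N.optSet, N.field q e = 1 := fun e he => by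
    rw [field_congr hqs (hc.optSet_subset he)]
    exact (hc.isOptPotential hconn).1 e he
  refine hc.induction hconn hqs hq₀ (fun i hi => ?_) ?_
  · refine hconn.induction (G := fun i => ∃ C, ∀ t, 0 ≤ t →
      |(P t i - t * q i) - (P t r - t * q r)| ≤ C) (fun e he => ?_) hr hi ⟨0, by simp⟩
    obtain ⟨C, hC⟩ := h.abs_drop_le_of_mem_optSet hq hq₁ he
    constructor
    · rintro ⟨C', hC'⟩
      refine ⟨C + C', fun t ht => ?_⟩
      have h₁ := abs_le.1 (hC t ht)
      have h₂ := abs_le.1 (hC' t ht)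
      exact abs_le.2 ⟨by linarith, by linarith⟩
    · rintro ⟨C', hC'⟩
      refine ⟨C + C', fun t ht => ?_⟩
      have h₁ := abs_le.1 (hC t ht)
      have h₂ := abs_le.1 (hC' t ht)
      exact abs_le.2 ⟨by linarith, by linarith⟩
  · intro H s π a c hH hs hG hqs' hw ha hc' hπH hπ e he
    have hb := support_subset_verts (optSet_nonempty hconn) hH
    have hK : ∀ f ∈ π, ∃ C, 0 ≤ C ∧ ∀ t, 0 ≤ t → N.field (P t) f ≤ s * t + C := fun f hf =>
      h.field_le hs.le hb hqs' hG (hπH f hf)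
    choose! K hK₀ hK using hK
    obtain ⟨M, hM₀, hM⟩ := exists_nonneg_forall_le fun f => N.len f * K f
    obtain ⟨Ca, hCa⟩ := hG a ha
    obtain ⟨Cc, hCc⟩ := hG c hc'
    refine ⟨M * π.length + Ca + Cc, fun t ht => ?_⟩
    obtain ⟨-, h₁⟩ := hw.abs_bound (u := fun i => P t i - t * q i) hM₀ fun f hf => by
      have h₂ := (N.field_le_iff (P t) f _).1 (hK f hf t ht)
      have h₃ := (N.field_eq_iff q f s).1 (hπ f hf).2
      have h₄ := hM f
      linear_combination h₂ + h₄ - t * h₃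
    obtain ⟨h₂, h₃⟩ := h₁ e he
    have h₄ := abs_le.1 (hCa t ht)
    have h₅ := abs_le.1 (hCc t ht)
    exact abs_le.2 ⟨by linarith, by linarith⟩

end TransshipmentProblem

/-! ### Exponential decay and soft thresholding -/

/-- Exponential decay of a function on `[0, ∞)`. -/
def ExpDecay (f : ℝ → ℝ) : Prop :=
  ∃ C ε, 0 < ε ∧ ∀ t, 0 ≤ t → |f t| ≤ C * Real.exp (-ε * t)

namespace ExpDecay

lemma of_abs_le {f g : ℝ → ℝ} (hg : ExpDecay g) (h : ∀ t, 0 ≤ t → |f t| ≤ |g t|) :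
    ExpDecay f := by
  obtain ⟨C, ε, hε, hC⟩ := hg
  exact ⟨C, ε, hε, fun t ht => (h t ht).trans (hC t ht)⟩

lemma zero : ExpDecay fun _ => 0 := ⟨0, 1, one_pos, by simp⟩

lemma exp {ε : ℝ} (hε : 0 < ε) : ExpDecay fun t => Real.exp (-ε * t) :=
  ⟨1, ε, hε, fun t _ => by simp⟩

lemma const_mul {f : ℝ → ℝ} (hf : ExpDecay f) (c : ℝ) : ExpDecay fun t => c * f t := by
  obtain ⟨C, ε, hε, hC⟩ := hf
  refine ⟨|c| * C, ε, hε, fun t ht => ?_⟩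
  rw [abs_mul, mul_assoc]
  exact mul_le_mul_of_nonneg_left (hC t ht) (abs_nonneg c)

lemma abs {f : ℝ → ℝ} (hf : ExpDecay f) : ExpDecay fun t => |f t| :=
  hf.of_abs_le fun _ _ => (abs_abs _).le

lemma add {f g : ℝ → ℝ} (hf : ExpDecay f) (hg : ExpDecay g) : ExpDecay fun t => f t + g t := by
  obtain ⟨C, ε, hε, hC⟩ := hf
  obtain ⟨C', ε', hε', hC'⟩ := hg
  have hexp : ∀ ε₁, min ε ε' ≤ ε₁ → ∀ t, 0 ≤ t →
      Real.exp (-ε₁ * t) ≤ Real.exp (-(min ε ε') * t) := fun ε₁ h t ht =>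
    Real.exp_le_exp.2 (by nlinarith)
  refine ⟨|C| + |C'|, min ε ε', lt_min hε hε', fun t ht => ?_⟩
  have h₁ := mul_le_mul (le_abs_self C) (hexp ε (min_le_left _ _) t ht) (Real.exp_pos _).le
    (abs_nonneg C)
  have h₂ := mul_le_mul (le_abs_self C') (hexp ε' (min_le_right _ _) t ht) (Real.exp_pos _).le
    (abs_nonneg C')
  have h₃ := hC t ht
  have h₄ := hC' t ht
  have h₅ := abs_add_le (f t) (g t)
  linarith

lemma sum {ι : Type*} {S : Finset ι} {f : ι → ℝ → ℝ} (h : ∀ i ∈ S, ExpDecay (f i)) :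
    ExpDecay fun t => ∑ i ∈ S, f i t := by
  classical
  induction S using Finset.induction_on with
  | empty => simpa using zero
  | insert j S hj ih =>
    simp only [Finset.sum_insert hj]
    exact (h j (by simp)).add (ih fun i hi => h i (by simp [hi]))

lemma of_sq {f : ℝ → ℝ} (hf : ExpDecay fun t => f t ^ 2) : ExpDecay f := by
  obtain ⟨C, ε, hε, hC⟩ := hf
  refine ⟨Real.sqrt |C|, ε / 2, half_pos hε, fun t ht => ?_⟩
  have h₁ : f t ^ 2 ≤ |C| * Real.exp (-ε * t) :=
    ((le_abs_self _).trans (hC t ht)).trans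
      (mul_le_mul_of_nonneg_right (le_abs_self C) (Real.exp_pos _).le)
  refine abs_le_of_sq_le_sq ?_ (by positivity)
  rw [mul_pow, Real.sq_sqrt (abs_nonneg C), ← Real.exp_nat_mul]
  refine h₁.trans (le_of_eq ?_)
  congr 2
  push_cast
  ring

lemma eventually_le {f : ℝ → ℝ} (hf : ExpDecay f) :
    ∃ c : ℝ, 0 < c ∧ ∀ᶠ t in Filter.atTop, |f t| ≤ Real.exp (-c * t) := by
  obtain ⟨C, ε, hε, hC⟩ := hf
  refine ⟨ε / 2, half_pos hε, ?_⟩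
  filter_upwards [Filter.eventually_ge_atTop 0, Filter.eventually_ge_atTop (C / (ε / 2))]
    with t ht htC
  have h₁ : C ≤ Real.exp (ε / 2 * t) := by
    rw [div_le_iff₀ (half_pos hε)] at htC
    linarith [Real.add_one_le_exp (ε / 2 * t)]
  calc |f t| ≤ C * Real.exp (-ε * t) := hC t ht
    _ ≤ Real.exp (ε / 2 * t) * Real.exp (-ε * t) :=
      mul_le_mul_of_nonneg_right h₁ (Real.exp_pos _).le
    _ = Real.exp (-(ε / 2) * t) := by
      rw [← Real.exp_add]
      congr 1
      ring

end ExpDecay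

/-- Soft thresholding: the part of `x` outside the interval `[-η, η]`. -/
noncomputable def softThreshold (η x : ℝ) : ℝ := x - max (-η) (min η x)

lemma softThreshold_of_abs_le {η x : ℝ} (h : |x| ≤ η) : softThreshold η x = 0 := by
  rw [softThreshold, min_eq_right (abs_le.1 h).2, max_eq_right (abs_le.1 h).1, sub_self]

lemma abs_softThreshold_le {η : ℝ} (hη : 0 ≤ η) (x : ℝ) : |softThreshold η x| ≤ |x| := by
  rw [softThreshold]
  rcases max_cases (-η) (min η x) with h | h <;> rcases min_cases η x with h' | h' <;>
    rcases abs_cases x with h'' | h'' <;> rw [abs_le] <;> constructor <;> linarith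

lemma abs_le_add_abs_softThreshold {η : ℝ} (hη : 0 ≤ η) (x : ℝ) :
    |x| ≤ η + |softThreshold η x| := by
  have h₁ : |max (-η) (min η x)| ≤ η :=
    abs_le.2 ⟨le_max_left _ _, max_le (by linarith) (min_le_left _ _)⟩
  have h₂ := abs_add_le (max (-η) (min η x)) (softThreshold η x)
  rw [softThreshold, add_sub_cancel] at h₂
  rw [softThreshold]
  linarith

/-- Soft thresholding is firmly nonexpansive, as it is monotone and `1`-Lipschitz. -/
lemma sq_sub_softThreshold_le (η x y : ℝ) :
    (softThreshold η x - softThreshold η y) ^ 2 ≤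
      (x - y) * (softThreshold η x - softThreshold η y) := by
  rcases le_total y x with h | h
  · have h₁ : max (-η) (min η y) ≤ max (-η) (min η x) := max_le_max le_rfl (min_le_min le_rfl h)
    have h₂ : max (-η) (min η x) - max (-η) (min η y) ≤ x - y := by
      have := abs_max_sub_max_le_max (-η) (min η x) (-η) (min η y)
      have h₃ := abs_min_sub_min_le_max η x η y
      simp only [sub_self, abs_zero, abs_nonneg, sup_of_le_right] at this h₃
      have h₄ := le_abs_self (max (-η) (min η x) - max (-η) (min η y))
      rw [abs_of_nonneg (sub_nonneg.2 h)] at h₃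
      linarith
    simp only [softThreshold]
    nlinarith
  · have h₁ : max (-η) (min η x) ≤ max (-η) (min η y) := max_le_max le_rfl (min_le_min le_rfl h)
    have h₂ : max (-η) (min η y) - max (-η) (min η x) ≤ y - x := by
      have := abs_max_sub_max_le_max (-η) (min η y) (-η) (min η x)
      have h₃ := abs_min_sub_min_le_max η y η x
      simp only [sub_self, abs_zero, abs_nonneg, sup_of_le_right] at this h₃
      have h₄ := le_abs_self (max (-η) (min η y) - max (-η) (min η x))
      rw [abs_of_nonneg (sub_nonneg.2 h)] at h₃
      linarith
    simp only [softThreshold]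
    nlinarith

namespace TransshipmentProblem

variable {V E : Type*} [Fintype V] [Fintype E] [DecidableEq V] {N : TransshipmentProblem V E}

/-! ### Energy estimates for the potentials -/

/-- Kirchhoff's equations for `p`, tested with a function `u` obtained from `p - q` by truncation
that is constant along the arcs on which the field of `q` exceeds `s`. -/
lemma energy_le {σ : E → ℝ} (hσ : ∀ e, 0 < σ e) {p q u : V → ℝ} {s M : ℝ} (hs : 0 ≤ s)
    (hp : N.boundary.mulVec (N.current σ p) = N.b)
    (hu : ∀ e, (u (N.tail e) - u (N.head e)) ^ 2 ≤
      ((p (N.tail e) - q (N.tail e)) - (p (N.head e) - q (N.head e))) *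
        (u (N.tail e) - u (N.head e)))
    (hM : ∀ i, |u i| ≤ M) (hb : (1 - s) * ∑ i, N.b i * u i = 0)
    (hq : ∀ e, s < N.field q e → u (N.tail e) = u (N.head e)) (e : E) :
    σ e * (u (N.tail e) - u (N.head e)) ^ 2 / N.len e ≤
      M * (2 * ∑ f, max (s - N.field q f) 0 * σ f + s * ∑ i, |N.boundary.mulVec σ i - N.b i|) := by
  have h₁ := boundary_mulVec_eq_iff.1 hp u
  have h₂ := N.sum_boundary_mulVec_mul σ u
  have hterm : ∀ f, σ f * (u (N.tail f) - u (N.head f)) ^ 2 / N.len f ≤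
      N.current σ p f * (u (N.tail f) - u (N.head f)) -
        s * (σ f * (u (N.tail f) - u (N.head f))) +
        max (s - N.field q f) 0 * σ f * (2 * M) := by
    intro f
    have hlen := N.len_pos f
    have h₃ : σ f * (u (N.tail f) - u (N.head f)) ^ 2 / N.len f ≤
        σ f * (N.field p f - N.field q f) * (u (N.tail f) - u (N.head f)) := by
      rw [div_le_iff₀ hlen]
      have h₄ := mul_le_mul_of_nonneg_left (hu f) (hσ f).le
      have h₅ := N.field_mul_len p f
      have h₆ := N.field_mul_len q f
      refine h₄.trans (le_of_eq ?_)
      linear_combination (σ f * (u (N.tail f) - u (N.head f))) * (h₆ - h₅)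
    have h₄ : σ f * (s - N.field q f) * (u (N.tail f) - u (N.head f)) ≤
        max (s - N.field q f) 0 * σ f * (2 * M) := by
      rcases lt_or_ge s (N.field q f) with h | h
      · rw [hq f h, sub_self, mul_zero, max_eq_right (by linarith)]
        simp
      · rw [max_eq_left (by linarith), mul_comm (σ f)]
        refine mul_le_mul_of_nonneg_left ?_ (mul_nonneg (by linarith) (hσ f).le)
        have h₅ := abs_le.1 (hM (N.tail f))
        have h₆ := abs_le.1 (hM (N.head f))
        linarith
    simp only [current]
    linarith
  have h₃ : σ e * (u (N.tail e) - u (N.head e)) ^ 2 / N.len e ≤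
      ∑ f, σ f * (u (N.tail f) - u (N.head f)) ^ 2 / N.len f :=
    Finset.single_le_sum (f := fun f => σ f * (u (N.tail f) - u (N.head f)) ^ 2 / N.len f)
      (fun f _ => div_nonneg (mul_nonneg (hσ f).le (sq_nonneg _)) (N.len_pos f).le)
      (Finset.mem_univ e)
  have h₄ := h₃.trans (Finset.sum_le_sum fun f _ => hterm f)
  rw [Finset.sum_add_distrib, Finset.sum_sub_distrib, ← Finset.mul_sum, ← Finset.sum_mul, h₁,
    ← h₂] at h₄
  have h₅ : ∑ i, N.b i * u i - ∑ i, N.boundary.mulVec σ i * u i ≤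
      M * ∑ i, |N.boundary.mulVec σ i - N.b i| := by
    rw [← Finset.sum_sub_distrib, Finset.mul_sum]
    refine Finset.sum_le_sum fun i _ => ?_
    rw [← sub_mul]
    calc (N.b i - N.boundary.mulVec σ i) * u i ≤ |(N.b i - N.boundary.mulVec σ i) * u i| :=
        le_abs_self _
      _ = |u i| * |N.boundary.mulVec σ i - N.b i| := by
        rw [abs_mul, abs_sub_comm, mul_comm]
      _ ≤ M * |N.boundary.mulVec σ i - N.b i| :=
        mul_le_mul_of_nonneg_right (hM i) (abs_nonneg _)
  have h₆ := mul_le_mul_of_nonneg_left h₅ hs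
  linarith

/-- The maximum principle, for an arbitrary truncation: the potential of the currents takes its
extreme values on `V(Ĥ)`, as this set contains the support of `b`. -/
lemma truncation_eq_zero (hne : N.optSet.Nonempty) {σ : E → ℝ} (hσ : ∀ e, 0 < σ e) {p : V → ℝ}
    (hp : N.boundary.mulVec (N.current σ p) = N.b) {τ : ℝ → ℝ}
    (hτ : ∀ x y, (τ x - τ y) ^ 2 ≤ (x - y) * (τ x - τ y))
    (h₀ : ∀ i ∈ N.verts N.optSet, τ (p i) = 0) (i : V) : τ (p i) = 0 := by
  obtain ⟨M, -, hM⟩ := exists_nonneg_forall_le fun i => |τ (p i)|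
  have hb : ∑ i, N.b i * τ (p i) = 0 := Finset.sum_eq_zero fun i _ => by
    by_cases hi : i ∈ N.verts N.optSet
    · rw [h₀ i hi, mul_zero]
    · rw [b_eq_zero_of_notMem_verts hne hi, zero_mul]
  have hconst : ∀ e, τ (p (N.tail e)) = τ (p (N.head e)) := fun e => by
    have h₁ := energy_le (N := N) (q := 0) (u := fun i => τ (p i)) (s := 0) hσ le_rfl hp
      (fun e => by simpa using hτ (p (N.tail e)) (p (N.head e))) hM (by rw [hb, mul_zero])
      (fun e he => by simp [field] at he) e
    simp only [field, Pi.zero_apply, sub_self, zero_div, max_self, zero_mul,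
      Finset.sum_const_zero, mul_zero, add_zero] at h₁
    rw [div_le_iff₀ (N.len_pos e), zero_mul] at h₁
    have h₂ : (τ (p (N.tail e)) - τ (p (N.head e))) ^ 2 ≤ 0 :=
      nonpos_of_mul_nonpos_right h₁ (hσ e)
    have h₃ : τ (p (N.tail e)) - τ (p (N.head e)) = 0 := by nlinarith
    linarith
  obtain ⟨e, he⟩ := hne
  exact N.induction_of_connected (G := fun i => τ (p i) = 0) (fun e => by rw [hconst e])
    (h₀ _ (tail_mem_verts he)) i

/-- A potential of currents with lowest value zero takes this value on `V(Ĥ)`. -/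
lemma exists_eq_zero_of_isLeast (hne : N.optSet.Nonempty) {σ : E → ℝ} (hσ : ∀ e, 0 < σ e)
    {p : V → ℝ} (hp : N.boundary.mulVec (N.current σ p) = N.b) (hmin : IsLeast (Set.range p) 0) :
    ∃ k ∈ N.verts N.optSet, p k = 0 := by
  obtain ⟨e, he⟩ := hne
  obtain ⟨k, hk, hkmin⟩ := (Set.toFinite (N.verts N.optSet)).exists_minimalFor p _
    ⟨_, tail_mem_verts he⟩
  have hle : ∀ i ∈ N.verts N.optSet, p k ≤ p i := fun i hi => by
    rcases le_total (p i) (p k) with h | h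
    · exact hkmin hi h
    · exact h
  have hτ : ∀ x y : ℝ, (min (x - p k) 0 - min (y - p k) 0) ^ 2 ≤
      (x - y) * (min (x - p k) 0 - min (y - p k) 0) := by
    intro x y
    rcases min_cases (x - p k) 0 with ⟨h₁, h₂⟩ | ⟨h₁, h₂⟩ <;>
      rcases min_cases (y - p k) 0 with ⟨h₃, h₄⟩ | ⟨h₃, h₄⟩ <;> rw [h₁, h₃] <;> nlinarith
  obtain ⟨⟨i, hi⟩, hlow⟩ := hmin
  have h₁ := truncation_eq_zero ⟨e, he⟩ hσ hp hτ
    (fun j hj => min_eq_right (sub_nonneg.2 (hle j hj))) i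
  have h₂ := min_eq_right_iff.1 h₁
  have h₃ : 0 ≤ p k := hlow ⟨k, rfl⟩
  exact ⟨k, hk, by linarith⟩

/-! ### Convergence of the potentials -/

lemma IsPenaltyPath.pos_of_nonneg {σ : ℝ → E → ℝ} {P : ℝ → V → ℝ} (h : N.IsPenaltyPath σ P)
    {t : ℝ} (ht : 0 ≤ t) (e : E) : 0 < σ t e := by
  rw [h.eq_exp t ht e]
  exact mul_pos (h.pos e) (Real.exp_pos _)

/-- The potential of the currents has bounded oscillation, since the energy is at most that of an
optimal flow. -/
lemma IsPenaltyPath.abs_potential_sub_le (hconn : N.ConnectedSub N.optSet) {σ : ℝ → E → ℝ}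
    {P p : ℝ → V → ℝ} (h : N.IsPenaltyPath σ P)
    (hp : ∀ t, 0 ≤ t → N.boundary.mulVec (N.current (σ t) (p t)) = N.b) {r : V}
    (hr : r ∈ N.verts N.optSet)
    (hσ : ∀ e ∈ N.optSet, ∃ C, ∀ t, 0 ≤ t → 1 ≤ C * σ t e) :
    ∃ M, 0 ≤ M ∧ ∀ t, 0 ≤ t → ∀ i, |p t i - p t r| ≤ M := by
  have hne := optSet_nonempty hconn
  obtain ⟨φ, hφ, -⟩ := exists_optFlow_pos hne
  choose! C hC using hσ
  have henergy : ∀ t, 0 ≤ t → ∀ e, N.len e * (σ t e * N.field (p t) e ^ 2) ≤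
      ∑ f, N.len f * (φ f ^ 2 * |C f|) := by
    intro t ht e
    have h₁ := boundary_mulVec_eq_iff.1 (hp t ht) (p t)
    rw [← boundary_mulVec_eq_iff.1 hφ.1.1 (p t)] at h₁
    have h₂ : ∑ f, N.len f * (σ t f * N.field (p t) f ^ 2) =
        ∑ f, N.current (σ t) (p t) f * (p t (N.tail f) - p t (N.head f)) :=
      Finset.sum_congr rfl fun f _ => by
        rw [current, ← field_mul_len]
        ring
    have h₃ : ∀ f, φ f * (p t (N.tail f) - p t (N.head f)) ≤
        N.len f * (φ f ^ 2 * |C f|) / 2 + N.len f * (σ t f * N.field (p t) f ^ 2) / 2 := by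
      intro f
      have hpos := h.pos_of_nonneg ht f
      have hlen := N.len_pos f
      rw [← field_mul_len]
      by_cases hf : f ∈ N.optSet
      · have h₄ : 1 ≤ |C f| * σ t f :=
          (hC f hf t ht).trans (mul_le_mul_of_nonneg_right (le_abs_self _) hpos.le)
        have h₅ : 2 * (φ f * N.field (p t) f) ≤
            φ f ^ 2 * |C f| + σ t f * N.field (p t) f ^ 2 := by
          have h₆ : 0 ≤ (φ f - σ t f * N.field (p t) f) ^ 2 / σ t f := by positivity
          have h₇ : (φ f - σ t f * N.field (p t) f) ^ 2 / σ t f =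
              φ f ^ 2 / σ t f - 2 * (φ f * N.field (p t) f) + σ t f * N.field (p t) f ^ 2 := by
            field_simp
            ring
          have h₈ : φ f ^ 2 / σ t f ≤ φ f ^ 2 * |C f| := by
            rw [div_le_iff₀ hpos, mul_assoc]
            exact le_mul_of_one_le_right (sq_nonneg _) h₄
          linarith
        have := mul_le_mul_of_nonneg_left h₅ hlen.le
        linarith
      · rw [hφ.eq_zero hf]
        have : 0 ≤ N.len f * (σ t f * N.field (p t) f ^ 2) := by positivity
        simp only [zero_mul, ne_eq, OfNat.ofNat_ne_zero, not_false_eq_true, zero_pow, mul_zero,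
          zero_div, zero_add]
        linarith
    have h₄ := Finset.sum_le_sum fun f (_ : f ∈ Finset.univ) => h₃ f
    rw [Finset.sum_add_distrib, ← Finset.sum_div, ← Finset.sum_div] at h₄
    have h₅ := Finset.single_le_sum (f := fun f => N.len f * (σ t f * N.field (p t) f ^ 2))
      (fun f _ => mul_nonneg (N.len_pos f).le
        (mul_nonneg (h.pos_of_nonneg ht f).le (sq_nonneg _))) (Finset.mem_univ e)
    linarith
  have hopt : ∀ i ∈ N.verts N.optSet, ∃ M, ∀ t, 0 ≤ t → |p t i - p t r| ≤ M := by
    intro i hi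
    refine hconn.induction (G := fun i => ∃ M, ∀ t, 0 ≤ t → |p t i - p t r| ≤ M)
      (fun e he => ?_) hr hi ⟨0, by simp⟩
    obtain ⟨K, hK⟩ : ∃ K, ∀ t, 0 ≤ t → |p t (N.tail e) - p t (N.head e)| ≤ K := by
      refine ⟨Real.sqrt (N.len e * (|C e| * ∑ f, N.len f * (φ f ^ 2 * |C f|))),
        fun t ht => Real.abs_le_sqrt ?_⟩
      have hpos := h.pos_of_nonneg ht e
      have hlen := N.len_pos e
      have h₁ := henergy t ht e
      have h₂ : 1 ≤ |C e| * σ t e :=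
        (hC e he t ht).trans (mul_le_mul_of_nonneg_right (le_abs_self _) hpos.le)
      rw [← field_mul_len]
      have h₃ : N.len e * (|C e| * (N.len e * (σ t e * N.field (p t) e ^ 2))) ≤
          N.len e * (|C e| * ∑ f, N.len f * (φ f ^ 2 * |C f|)) :=
        mul_le_mul_of_nonneg_left (mul_le_mul_of_nonneg_left h₁ (abs_nonneg _)) hlen.le
      refine le_trans ?_ h₃
      have h₄ := mul_le_mul_of_nonneg_right h₂ (sq_nonneg (N.field (p t) e * N.len e))
      linarith
    constructor
    · rintro ⟨M, hM⟩
      refine ⟨M + K, fun t ht => ?_⟩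
      have h₁ := abs_le.1 (hM t ht)
      have h₂ := abs_le.1 (hK t ht)
      exact abs_le.2 ⟨by linarith, by linarith⟩
    · rintro ⟨M, hM⟩
      refine ⟨M + K, fun t ht => ?_⟩
      have h₁ := abs_le.1 (hM t ht)
      have h₂ := abs_le.1 (hK t ht)
      exact abs_le.2 ⟨by linarith, by linarith⟩
  choose! M hM using hopt
  obtain ⟨M', hM'₀, hM'⟩ := exists_nonneg_forall_le M
  refine ⟨M', hM'₀, fun t ht i => ?_⟩
  have h₁ := truncation_eq_zero (τ := fun x => softThreshold M' (x - p t r)) hne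
    (h.pos_of_nonneg ht) (hp t ht)
    (fun x y => by simpa using sq_sub_softThreshold_le M' (x - p t r) (y - p t r))
    (fun i hi => softThreshold_of_abs_le ((hM i hi t ht).trans (hM' i))) i
  have h₂ := abs_le_add_abs_softThreshold hM'₀ (p t i - p t r)
  rw [h₁] at h₂
  simpa using h₂

/-- One level of the convergence proof. Write `v = p - q`. If `v` converges exponentially at the
ends of all arcs with `Ψ(q) > s`, then its exponential convergence propagates along the arcs with
`Ψ(q) = s`, whose conductivities dominate those of the remaining arcs exponentially. -/
lemma IsPenaltyPath.expDecay_iff {σ : ℝ → E → ℝ} {P p : ℝ → V → ℝ} (h : N.IsPenaltyPath σ P)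
    (hp : ∀ t, 0 ≤ t → N.boundary.mulVec (N.current (σ t) (p t)) = N.b) {q : V → ℝ} {r : V}
    {M s : ℝ} (hM : ∀ t, 0 ≤ t → ∀ i, |(p t i - q i) - (p t r - q r)| ≤ M) (hs : 0 ≤ s)
    (hb : s = 1 ∨ ∀ i ∈ Function.support N.b, ExpDecay fun t => (p t i - q i) - (p t r - q r))
    (hq : ∀ e, s < N.field q e → (ExpDecay fun t =>
      (p t (N.tail e) - q (N.tail e)) - (p t r - q r)) ∧
      ExpDecay fun t => (p t (N.head e) - q (N.head e)) - (p t r - q r))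
    (hσ : ∀ e, N.field q e < s → ExpDecay fun t => Real.exp ((1 - s) * t) * σ t e)
    (hexp : ExpDecay fun t => Real.exp ((1 - s) * t) * Real.exp (-t))
    {e : E} (he : ∃ C, ∀ t, 0 ≤ t → Real.exp (-(1 - s) * t) ≤ C * σ t e) :
    (ExpDecay fun t => (p t (N.tail e) - q (N.tail e)) - (p t r - q r)) ↔
      ExpDecay fun t => (p t (N.head e) - q (N.head e)) - (p t r - q r) := by
  classical
  set v : V → ℝ → ℝ := fun i t => (p t i - q i) - (p t r - q r) with hv
  -- Thresholding at level `η` annihilates `v` wherever it is known to decay.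
  set η : ℝ → ℝ := fun t => ∑ i with ExpDecay (v i), |v i t| with hη
  have hηdecay : ExpDecay η := ExpDecay.sum fun i hi => (Finset.mem_filter.1 hi).2.abs
  have hη₀ : ∀ t, 0 ≤ η t := fun t => Finset.sum_nonneg fun _ _ => abs_nonneg _
  have hvη : ∀ i, ExpDecay (v i) → ∀ t, |v i t| ≤ η t := fun i hi t =>
    Finset.single_le_sum (f := fun i => |v i t|) (fun _ _ => abs_nonneg _)
      (Finset.mem_filter.2 ⟨Finset.mem_univ i, hi⟩)
  set u : ℝ → V → ℝ := fun t i => softThreshold (η t) (v i t) with hu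
  have hu₀ : ∀ i, ExpDecay (v i) → ∀ t, u t i = 0 := fun i hi t =>
    softThreshold_of_abs_le (hvη i hi t)
  have hdelta : ExpDecay fun t => u t (N.tail e) - u t (N.head e) := by
    obtain ⟨C, hC⟩ := he
    refine ExpDecay.of_sq ?_
    have hA : ExpDecay fun t => N.len e * |C| * (M * (2 * ∑ f, max (s - N.field q f) 0 *
        (Real.exp ((1 - s) * t) * σ t f) + s * ∑ i, |N.boundary.mulVec (σ 0) i - N.b i| *
          (Real.exp ((1 - s) * t) * Real.exp (-t)))) := by
      refine ((((ExpDecay.sum fun f _ => ?_).const_mul 2).add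
        ((ExpDecay.sum fun i _ => hexp.const_mul _).const_mul s)).const_mul M).const_mul _
      rcases lt_or_ge (N.field q f) s with hf | hf
      · exact (hσ f hf).const_mul _
      · simpa [max_eq_right (sub_nonpos.2 hf)] using ExpDecay.zero
    refine hA.of_abs_le fun t ht => ?_
    rw [abs_of_nonneg (sq_nonneg _)]
    refine le_trans ?_ (le_abs_self _)
    have hpos := h.pos_of_nonneg ht
    have hlen := N.len_pos e
    have h₁ := energy_le (N := N) (q := q) (u := u t) (s := s) (M := M) hpos hs (hp t ht)
      (fun f => by
        have := sq_sub_softThreshold_le (η t) (v (N.tail f) t) (v (N.head f) t)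
        simp only [hv, sub_sub_sub_cancel_right] at this
        exact this)
      (fun i => (abs_softThreshold_le (hη₀ t) _).trans (hM t ht i)) (by
        rcases hb with rfl | hb
        · simp
        · rw [Finset.sum_eq_zero, mul_zero]
          intro i _
          by_cases hi : N.b i = 0
          · rw [hi, zero_mul]
          · rw [hu₀ i (hb i hi) t, mul_zero])
      (fun f hf => by rw [hu₀ _ (hq f hf).1 t, hu₀ _ (hq f hf).2 t]) e
    rw [div_le_iff₀ hlen] at h₁
    have h₂ : 1 ≤ |C| * (Real.exp ((1 - s) * t) * σ t e) := by
      have h₃ := mul_le_mul_of_nonneg_left (hC t ht) (Real.exp_pos ((1 - s) * t)).le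
      rw [← Real.exp_add] at h₃
      have h₄ : (1 - s) * t + -(1 - s) * t = 0 := by ring
      rw [h₄, Real.exp_zero] at h₃
      have h₅ := mul_le_mul_of_nonneg_right (le_abs_self C)
        (mul_pos (Real.exp_pos ((1 - s) * t)) (hpos e)).le
      linarith
    have h₃ := mul_le_mul_of_nonneg_right h₂ (sq_nonneg (u t (N.tail e) - u t (N.head e)))
    have h₄ := mul_le_mul_of_nonneg_left h₁
      (mul_nonneg (abs_nonneg C) (Real.exp_pos ((1 - s) * t)).le)
    have h₅ : ∀ i, |N.boundary.mulVec (σ t) i - N.b i| =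
        |N.boundary.mulVec (σ 0) i - N.b i| * Real.exp (-t) := fun i => by
      rw [h.boundary_eq t ht i, add_sub_cancel_left, abs_mul, abs_of_pos (Real.exp_pos _),
        mul_comm]
    simp only [h₅, ← Finset.sum_mul] at h₄
    have h₆ : ∑ f, max (s - N.field q f) 0 * (Real.exp ((1 - s) * t) * σ t f) =
        Real.exp ((1 - s) * t) * ∑ f, max (s - N.field q f) 0 * σ t f := by
      rw [Finset.mul_sum]
      exact Finset.sum_congr rfl fun f _ => by ring
    rw [h₆, ← Finset.sum_mul]
    linarith
  have habs : ∀ i t, |v i t| ≤ η t + |u t i| := fun i t =>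
    abs_le_add_abs_softThreshold (hη₀ t) _
  have huv : ∀ i t, |u t i| ≤ |v i t| := fun i t => abs_softThreshold_le (hη₀ t) _
  constructor
  · intro ht
    refine (((hηdecay.add ht.abs).add hdelta.abs)).of_abs_le fun t _ => ?_
    refine le_trans ?_ (le_abs_self _)
    have h₁ := habs (N.head e) t
    have h₂ := huv (N.tail e) t
    have h₃ := abs_sub_abs_le_abs_sub (u t (N.head e)) (u t (N.tail e))
    rw [abs_sub_comm] at h₃
    linarith
  · intro ht
    refine (((hηdecay.add ht.abs).add hdelta.abs)).of_abs_le fun t _ => ?_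
    refine le_trans ?_ (le_abs_self _)
    have h₁ := habs (N.tail e) t
    have h₂ := huv (N.head e) t
    have h₃ := abs_sub_abs_le_abs_sub (u t (N.tail e)) (u t (N.head e))
    linarith

/-- Up to additive constants, the potentials converge exponentially on `V(Hs)`. -/
lemma IsPenaltyPath.expDecay (hconn : N.ConnectedSub N.optSet) {σ : ℝ → E → ℝ}
    {P p : ℝ → V → ℝ} (h : N.IsPenaltyPath σ P)
    (hp : ∀ t, 0 ≤ t → N.boundary.mulVec (N.current (σ t) (p t)) = N.b)
    {Hs : Set E} {ps q : V → ℝ} (hc : N.IsConstructed Hs ps) (hqs : Set.EqOn q ps (N.verts Hs))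
    (hq₀ : ∀ e ∉ Hs, N.field q e ≤ 0) {r : V} (hr : r ∈ N.verts N.optSet) :
    ∀ i ∈ N.verts Hs, ExpDecay fun t => (p t i - q i) - (p t r - q r) := by
  have hne := optSet_nonempty hconn
  have hsub := hc.optSet_subset
  have hq : ∀ e, N.field q e ≤ 1 := fun e => by
    by_cases he : e ∈ Hs
    · rw [field_congr hqs he]
      exact hc.field_le_one hconn he
    · exact (hq₀ e he).trans zero_le_one
  have hq₁ : ∀ e ∈ N.optSet, N.field q e = 1 := fun e he => by
    rw [field_congr hqs (hsub he)]
    exact (hc.isOptPotential hconn).1 e he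
  have hbdd := h.bounded hconn hc hqs hq₀ hr
  have hfield : ∀ e ∈ Hs, ∃ K, ∀ t, 0 ≤ t → |N.field (P t) e - t * N.field q e| ≤ K := by
    intro e he
    obtain ⟨C₁, hC₁⟩ := hbdd _ (tail_mem_verts he)
    obtain ⟨C₂, hC₂⟩ := hbdd _ (head_mem_verts he)
    refine ⟨(C₁ + C₂) / N.len e, fun t ht => ?_⟩
    have hlen := N.len_pos e
    have habs := abs_mul (N.field (P t) e - t * N.field q e) (N.len e)
    rw [abs_of_pos hlen] at habs
    rw [le_div_iff₀ hlen, ← habs, sub_mul, mul_assoc,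
      field_mul_len, field_mul_len]
    have h₁ := abs_le.1 (hC₁ t ht)
    have h₂ := abs_le.1 (hC₂ t ht)
    exact abs_le.2 ⟨by linarith, by linarith⟩
  have hlower : ∀ e ∈ Hs, ∃ C, ∀ t, 0 ≤ t → Real.exp (-(1 - N.field q e) * t) ≤ C * σ t e := by
    intro e he
    obtain ⟨K, hK⟩ := hfield e he
    refine ⟨Real.exp K / σ 0 e, fun t ht => ?_⟩
    rw [h.eq_exp t ht e, ← mul_assoc, div_mul_cancel₀ _ (h.pos e).ne', ← Real.exp_add]
    refine Real.exp_le_exp.2 ?_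
    have := (abs_le.1 (hK t ht)).1
    linarith
  have hupper : ∀ s, 0 < s → ∀ e, N.field q e < s →
      ExpDecay fun t => Real.exp ((1 - s) * t) * σ t e := by
    intro s hs e he
    obtain ⟨C, ε, hε, hC⟩ : ∃ C ε, 0 < ε ∧ ∀ t, 0 ≤ t → N.field (P t) e ≤ (s - ε) * t + C := by
      by_cases heH : e ∈ Hs
      · obtain ⟨K, hK⟩ := hfield e heH
        refine ⟨K, s - N.field q e, sub_pos.2 he, fun t ht => ?_⟩
        have := (abs_le.1 (hK t ht)).2
        linarith
      · obtain ⟨C, -, hC⟩ := h.field_le le_rfl (support_subset_verts hne hsub) hq₀ hbdd heH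
        exact ⟨C, s, hs, fun t ht => by simpa using hC t ht⟩
    refine ((ExpDecay.exp hε).const_mul (σ 0 e * Real.exp C)).of_abs_le fun t ht => ?_
    have hσ₀ := h.pos e
    rw [h.eq_exp t ht e, abs_of_pos (by positivity), abs_of_pos (by positivity), mul_left_comm,
      mul_assoc, ← Real.exp_add, ← Real.exp_add]
    refine mul_le_mul_of_nonneg_left (Real.exp_le_exp.2 ?_) hσ₀.le
    have := hC t ht
    linarith
  have hexp : ∀ s, 0 < s → ExpDecay fun t => Real.exp ((1 - s) * t) * Real.exp (-t) :=
    fun s hs => (ExpDecay.exp hs).of_abs_le fun t _ => by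
      rw [← Real.exp_add]
      exact (congrArg (fun x => |Real.exp x|) (by ring)).le
  obtain ⟨M₀, -, hM₀⟩ := h.abs_potential_sub_le hconn hp hr fun e he => by
    obtain ⟨C, hC⟩ := hlower e (hsub he)
    exact ⟨C, fun t ht => by simpa [hq₁ e he] using hC t ht⟩
  obtain ⟨M₁, -, hM₁⟩ := exists_nonneg_forall_le fun i => |q i - q r|
  have hM : ∀ t, 0 ≤ t → ∀ i, |(p t i - q i) - (p t r - q r)| ≤ M₀ + M₁ := fun t ht i => by
    have h₁ := abs_le.1 (hM₀ t ht i)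
    have h₂ := abs_le.1 (hM₁ i)
    exact abs_le.2 ⟨by linarith, by linarith⟩
  refine hc.induction hconn hqs hq₀ (fun i hi => ?_) ?_
  · refine hconn.induction (G := fun i => ExpDecay fun t => (p t i - q i) - (p t r - q r))
      (fun e he => ?_) hr hi (by simpa using ExpDecay.zero)
    exact h.expDecay_iff hp hM zero_le_one (Or.inl rfl)
      (fun f hf => absurd (hq f) (not_le.2 hf)) (hupper 1 one_pos) (hexp 1 one_pos)
      (by simpa [hq₁ e he] using hlower e (hsub he))
  · intro H s π a c hH hs hG hqH hw ha _ _ hπ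
    refine hw.forall_head
      (G := fun i => ExpDecay fun t => (p t i - q i) - (p t r - q r)) (hG a ha) fun e he => ?_
    obtain ⟨heH, hes⟩ := hπ e he
    refine (h.expDecay_iff hp hM hs.le (Or.inr fun i hi => hG i (support_subset_verts hne hH hi))
      (fun f hf => ?_) (hupper s hs) (hexp s hs) (by simpa only [hes] using hlower e heH)).1
    have hfH : f ∈ H := by
      by_contra hfH
      exact absurd (hqH f hfH) (not_le.2 hf)
    exact ⟨hG _ (tail_mem_verts hfH), hG _ (head_mem_verts hfH)⟩

lemma IsPhysarumRun.eventually_abs_sub_le [DecidableEq E] (hconn : N.ConnectedSub N.optSet)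
    {σ : ℝ → E → ℝ} {p : ℝ → V → ℝ} (h : N.IsPhysarumRun σ p) {Hs : Set E} {ps : V → ℝ}
    (hc : N.IsConstructed Hs ps) :
    ∃ c : ℝ, 0 < c ∧ ∀ᶠ t in atTop, ∀ i ∈ N.verts Hs, |p t i - ps i| ≤ Real.exp (-c * t) := by
  classical
  obtain ⟨P, hP⟩ := h.exists_isPenaltyPath
  obtain ⟨q, hqs, hq₀⟩ := hc.exists_extension
  obtain ⟨r, hr⟩ := hconn.nonempty_verts
  have hne := optSet_nonempty hconn
  have hverts := verts_mono (N := N) hc.optSet_subset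
  have hp : ∀ t, 0 ≤ t → N.boundary.mulVec (N.current (σ t) (p t)) = N.b := fun t ht => by
    rw [← laplacian_mulVec, h.kirchhoff t ht]
  have hdecay := hP.expDecay hconn hp hc hqs hq₀ hr
  set S : ℝ → ℝ := fun t => ∑ i with i ∈ N.verts Hs, |(p t i - q i) - (p t r - q r)| with hS
  have hSdecay : ExpDecay S := ExpDecay.sum fun i hi => (hdecay i (Finset.mem_filter.1 hi).2).abs
  have hle : ∀ t, ∀ i ∈ N.verts Hs, |(p t i - q i) - (p t r - q r)| ≤ S t := fun t i hi =>
    Finset.single_le_sum (f := fun i => |(p t i - q i) - (p t r - q r)|)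
      (fun _ _ => abs_nonneg _) (Finset.mem_filter.2 ⟨Finset.mem_univ i, hi⟩)
  -- On `V(Ĥ)` both `p t` and `ps` have minimum zero, which fixes the additive constant.
  have hroot : ∀ t, 0 ≤ t → |p t r - q r| ≤ S t := by
    intro t ht
    obtain ⟨k, hk, hpk⟩ := exists_eq_zero_of_isLeast hne (h.pos t ht) (hp t ht) (h.lowest t ht)
    obtain ⟨⟨j, hj, hpj⟩, hmin⟩ := (hc.isOptPotential hconn).2
    have h₁ : 0 ≤ q k := (hmin ⟨k, hk, rfl⟩).trans_eq (hqs (hverts hk)).symm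
    have h₂ : q j = 0 := (hqs (hverts hj)).trans hpj
    have h₃ : 0 ≤ p t j := (h.lowest t ht).2 ⟨j, rfl⟩
    have h₄ := abs_le.1 (hle t k (hverts hk))
    have h₅ := abs_le.1 (hle t j (hverts hj))
    exact abs_le.2 ⟨by linarith, by linarith⟩
  obtain ⟨c, hcpos, hev⟩ := (hSdecay.const_mul 2).eventually_le
  refine ⟨c, hcpos, ?_⟩
  filter_upwards [hev, eventually_ge_atTop 0] with t ht ht₀ i hi
  have h₁ := abs_le.1 (hle t i hi)
  have h₂ := abs_le.1 (hroot t ht₀)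
  have h₃ := le_abs_self (2 * S t)
  rw [← hqs hi]
  exact abs_le.2 ⟨by linarith, by linarith⟩

end TransshipmentProblem

theorem theorem2 {V E : Type*} [Fintype V] [Fintype E] [DecidableEq V] [DecidableEq E]
    (N : TransshipmentProblem V E)
    (hfeas : N.Feasible) (hconn : N.ConnectedSub N.optSet) :
    -- the construction has an outcome `(Hs, ps)`, and only one
    ∃ (Hs : Set E) (ps : V → ℝ),
      N.IsConstructed Hs ps ∧
      (∀ (H : Set E) (p : V → ℝ), N.IsConstructed H p → H = Hs ∧ Set.EqOn p ps (N.verts Hs)) ∧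
      -- it extends the optimal set and its (unique) potential
      N.optSet ⊆ Hs ∧ N.IsOptPotential ps ∧
      (∀ q : V → ℝ, N.IsOptPotential q → Set.EqOn q ps (N.verts N.optSet)) ∧
      -- it is the unique `∞`-harmonic extension to `Hs`
      N.IsInfHarmonic Hs (Function.support N.b) ps ∧
      (∀ q : V → ℝ, N.IsOptPotential q → N.IsInfHarmonic Hs (Function.support N.b) q →
        Set.EqOn q ps (N.verts Hs)) ∧
      -- it is feasible for, and part of an optimal solution of, the dual problem
      (∀ e, N.tail e ∈ N.verts Hs → N.head e ∈ N.verts Hs → N.field ps e ≤ 1) ∧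
      (∃ q : V → ℝ, N.IsDualOptimal q ∧ Set.EqOn q ps (N.verts Hs)) ∧
      -- the potentials of every run converge to it exponentially fast on `V(Hs)`
      ∀ (σ : ℝ → E → ℝ) (p : ℝ → V → ℝ), N.IsPhysarumRun σ p →
        ∃ c : ℝ, 0 < c ∧ ∀ᶠ t in atTop, ∀ i ∈ N.verts Hs,
          |p t i - ps i| ≤ Real.exp (-c * t) := by
  obtain ⟨Hs, ps, hc⟩ := TransshipmentProblem.exists_isConstructed hconn
  obtain ⟨q, hqs, hq₀⟩ := hc.exists_extension
  have hopt := hc.isOptPotential hconn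
  have hq : ∀ e, N.field q e ≤ 1 := fun e => by
    by_cases he : e ∈ Hs
    · rw [TransshipmentProblem.field_congr hqs he]
      exact hc.field_le_one hconn he
    · exact (hq₀ e he).trans zero_le_one
  have hq₁ : ∀ e ∈ N.optSet, N.field q e = 1 := fun e he => by
    rw [TransshipmentProblem.field_congr hqs (hc.optSet_subset he), hopt.1 e he]
  refine ⟨Hs, ps, hc, fun H p h => ?_, hc.optSet_subset, hopt, fun q' hq' => hq'.eqOn hconn hopt,
    hc.isInfHarmonic hconn, fun q' hq' hharm => ?_, fun e ht hh => ?_,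
    ⟨q, TransshipmentProblem.isDualOptimal_of_field
      (TransshipmentProblem.optSet_nonempty hconn) hq hq₁, hqs⟩,
    fun σ p h => h.eventually_abs_sub_le hconn hc⟩
  · obtain ⟨h₁, h₂⟩ := hc.subset_and_eqOn hconn h
    exact ⟨(h.subset_and_eqOn hconn hc).1.antisymm h₁, h₂⟩
  · obtain ⟨⟨p₀, hp₀, h₁⟩, -⟩ := hc
    exact (TransshipmentProblem.subset_and_eqOn_of_reflTransGen hconn hp₀
      (TransshipmentProblem.subset_of_reflTransGen h₁) hq' hharm h₁ fun e he => Or.inl he).2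
  · have h := hq e
    rwa [TransshipmentProblem.field, hqs ht, hqs hh] at h
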